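/- A plane field is given by a nowhere vanishing $C^\infty$ vector field $\xi:\mathbb{R}^3\to\mathbb{R}^3$ (the planes are those orthogonal to $\xi$). A vector $v\ne 0$ is a $\xi$-asymptotic direction at $p$ if $\langle \xi(p),v\rangle=0$ and $\langle d\xi_p(v),v\rangle=0$; a regular curve is a $\xi$-asymptotic line if its velocity is everywhere a $\xi$-asymptotic direction. A point $p$ is parabolic if the two $\xi$-asymptotic directions at $p$ coincide, or if every direction of the plane $\xi(p)^\perp$ is $\xi$-asymptotic. A smooth immersed curve $\gamma$ is of finite type if for every $x$ there is $k$ such that $\gamma'(x),\dots,\gamma^{(k)}(x)$ span $\mathbb{R}^3$. Let $\gamma$ be an $l$-periodic $\xi$-asymptotic line without parabolic points with $\gamma_1'\gamma_2''-\gamma_2'\gamma_1''\neq 0$ everywhere, and put $X=\gamma'$, $Y=(\gamma_2',-\gamma_1',0)$, $Z=X\times Y$ and $\alpha(x,y,z)=\gamma(x)+yY(x)+zZ(x)$. For $(y_0,z_0)$ near $(0,0)$ let $(y(x),z(x))$, $0\le x\le l$, with $(y(0),z(0))=(y_0,z_0)$, be such that $x\mapsto\alpha(x,y(x),z(x))$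 is a $\xi$-asymptotic line of the family containing $\gamma$ (i.e. $(y,z)$ and its $x$-derivative depend continuously on $(x,y_0,z_0)$, and $(y,z)\equiv(0,0)$ for $(y_0,z_0)=(0,0)$). The Poincaré map of $\gamma$ is the germ at $(0,0)$ of $\mathcal{P}(y_0,z_0)=(y(l),z(l))$, and $\gamma$ is hyperbolic if no eigenvalue of $d\mathcal{P}_{(0,0)}$ has modulus $1$. **Theorem 4.3.** The closed curve $\gamma(x)=(\sin x,\cos x,\sin^3 x)$, of period $2\pi$, is of finite type, and there is a plane field $\xi$ for which $\gamma$ is a hyperbolic closed $\xi$-asymptotic line without parabolic points. Moreover $\xi$ can be chosen so that the derivative of the Poincaré map in the coordinates $(y,z)$ is $$d\mathcal{P}_{(0,0)}=\begin{pmatrix} e^{2\pi} & 0\\ 0 & e^{-25\pi/8}\end{pmatrix}.$$ -/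

import Mathlib

open Real Set Topology
open scoped ContDiff Matrix

noncomputable section

/-- Euclidean three-space. -/
abbrev E3 : Type := EuclideanSpace ℝ (Fin 3)

/-- `γ` is of finite type at `x`: finitely many of its derivatives of order at least one
span the whole space. -/
def IsFiniteTypeAt (γ : ℝ → E3) (x : ℝ) : Prop :=
  ∃ k : ℕ, Submodule.span ℝ {v : E3 | ∃ j : ℕ, 1 ≤ j ∧ j ≤ k ∧ v = iteratedDeriv j γ x} = ⊤

/-- A smoothly immersed curve which is of finite type at every point. -/
def IsFiniteTypeCurve (γ : ℝ → E3) : Prop :=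
  ContDiff ℝ ∞ γ ∧ (∀ x, deriv γ x ≠ 0) ∧ ∀ x, IsFiniteTypeAt γ x

/-- `ξ` is a nowhere vanishing vector field of class `C^k`; the plane field that it defines
consists of the planes orthogonal to `ξ`. -/
def IsPlaneField (k : WithTop ℕ∞) (ξ : E3 → E3) : Prop :=
  ContDiff ℝ k ξ ∧ ∀ p, ξ p ≠ 0

/-- `v` is a `ξ`-asymptotic direction at `p`: `⟨ξ, dr⟩ = 0` and `⟨dξ(dr), dr⟩ = 0`. -/
def IsAsymptoticDirection (ξ : E3 → E3) (p v : E3) : Prop :=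
  v ≠ 0 ∧ inner ℝ (ξ p) v = 0 ∧ inner ℝ (fderiv ℝ ξ p v) v = 0

/-- The curve `c`, restricted to the interval `I`, is a `ξ`-asymptotic line: a regular `C^1` curve
whose velocity is everywhere a `ξ`-asymptotic direction. -/
def IsAsymptoticLineOn (ξ : E3 → E3) (I : Set ℝ) (c : ℝ → E3) : Prop :=
  ContDiffOn ℝ 1 c I ∧ ∀ t ∈ I, IsAsymptoticDirection ξ (c t) (derivWithin c I t)

/-- A closed `ξ`-asymptotic line, of period `l`. -/
def IsClosedAsymptoticLine (ξ : E3 → E3) (γ : ℝ → E3) (l : ℝ) : Prop :=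
  0 < l ∧ Function.Periodic γ l ∧ IsAsymptoticLineOn ξ univ γ

/-- At `p` the two `ξ`-asymptotic directions coincide, or all directions of the plane of the
field at `p` are `ξ`-asymptotic. -/
def IsParabolicPoint (ξ : E3 → E3) (p : E3) : Prop :=
  (∃ v, IsAsymptoticDirection ξ p v ∧ ∀ w, IsAsymptoticDirection ξ p w → ∃ t : ℝ, w = t • v) ∨
    ∀ v, v ≠ 0 → inner ℝ (ξ p) v = 0 → IsAsymptoticDirection ξ p v

/-- The projection of `γ` to the plane of the first two coordinates is a regular, locally
strictly convex curve. -/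
def HasLocallyConvexProjection (γ : ℝ → E3) : Prop :=
  ∀ x, (deriv γ x 0 ≠ 0 ∨ deriv γ x 1 ≠ 0) ∧
    deriv γ x 0 * iteratedDeriv 2 γ x 1 - deriv γ x 1 * iteratedDeriv 2 γ x 0 ≠ 0

/-- The frame `X = γ'`, `Y = (γ₂', -γ₁', 0)`, `Z = X × Y` along `γ`. -/
def frameX (γ : ℝ → E3) (x : ℝ) : E3 := deriv γ x

/-- Second vector of the frame. -/
def frameY (γ : ℝ → E3) (x : ℝ) : E3 := !₂[deriv γ x 1, -(deriv γ x 0), 0]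

/-- Third vector of the frame. -/
def frameZ (γ : ℝ → E3) (x : ℝ) : E3 :=
  WithLp.toLp 2 ((frameX γ x).ofLp ⨯₃ (frameY γ x).ofLp)

/-- The parametrization `α(x, y, z) = γ(x) + y Y(x) + z Z(x)` of a tubular neighbourhood of `γ`;
the transversal coordinates are `q = (y, z)`. -/
def tube (γ : ℝ → E3) (x : ℝ) (q : Fin 2 → ℝ) : E3 :=
  γ x + q 0 • frameY γ x + q 1 • frameZ γ x

/-- `φ x q = (y(x, q), z(x, q))`, for `x ∈ [0, l]` and initial values `q ∈ U`, describes the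
`ξ`-asymptotic lines near `γ`: it is equal to `q` at `x = 0`, it is zero for `q = 0` (the line `γ`
itself), the curve `x ↦ α(x, y, z)` is a `ξ`-asymptotic line, and `φ` and its derivative `ψ` with
respect to `x` are jointly continuous. Since two asymptotic directions pass through each point near
a line without parabolic points, the continuity of `ψ` is what selects the family of asymptotic
lines to which `γ` belongs. -/
structure IsAsymptoticFamily (ξ : E3 → E3) (γ : ℝ → E3) (l : ℝ) (U : Set (Fin 2 → ℝ))
    (φ ψ : ℝ → (Fin 2 → ℝ) → (Fin 2 → ℝ)) : Prop where
  initial : ∀ q ∈ U, φ 0 q = q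
  base : ∀ x ∈ Icc 0 l, φ x 0 = 0
  hasDeriv : ∀ q ∈ U, ∀ x ∈ Icc 0 l, HasDerivWithinAt (fun t => φ t q) (ψ x q) (Icc 0 l) x
  continuousOn : ContinuousOn (Function.uncurry φ) (Icc 0 l ×ˢ U)
  continuousOn_deriv : ContinuousOn (Function.uncurry ψ) (Icc 0 l ×ˢ U)
  asymptotic : ∀ q ∈ U, IsAsymptoticLineOn ξ (Icc 0 l) (fun x => tube γ x (φ x q))

/-- `P` is, near the origin, the Poincaré map of the closed `ξ`-asymptotic line `γ` of period `l`, on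
the section `x = 0` with coordinates `(y, z)`: it sends `q` to the point in which the asymptotic
line through `α(0, q)`, of the same family as `γ`, meets the section again at `x = l`. -/
def IsPoincareMap (ξ : E3 → E3) (γ : ℝ → E3) (l : ℝ) (P : (Fin 2 → ℝ) → (Fin 2 → ℝ)) : Prop :=
  ∃ U ∈ 𝓝 (0 : Fin 2 → ℝ), ∃ φ ψ : ℝ → (Fin 2 → ℝ) → (Fin 2 → ℝ),
    IsAsymptoticFamily ξ γ l U φ ψ ∧ ∀ q ∈ U, P q = φ l q

/-- The Poincaré map of `γ` exists near the origin, and its derivative at the origin has the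
matrix `D` in the coordinates `(y, z)`. -/
def HasPoincareDerivative (ξ : E3 → E3) (γ : ℝ → E3) (l : ℝ) (D : Matrix (Fin 2) (Fin 2) ℝ) :
    Prop :=
  (∃ P, IsPoincareMap ξ γ l P) ∧
    ∀ P, IsPoincareMap ξ γ l P →
      HasFDerivAt P (LinearMap.toContinuousLinearMap (Matrix.toLin' D)) 0

/-- `γ` is a hyperbolic closed `ξ`-asymptotic line of period `l`: it has no parabolic points, its
horizontal projection is locally strictly convex, and no complex eigenvalue of the derivative of
its Poincaré map lies on the unit circle. -/
def IsHyperbolicClosedLine (ξ : E3 → E3) (γ : ℝ → E3) (l : ℝ) : Prop :=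
  IsClosedAsymptoticLine ξ γ l ∧ (∀ x, ¬ IsParabolicPoint ξ (γ x)) ∧
    HasLocallyConvexProjection γ ∧
    ∃ D, HasPoincareDerivative ξ γ l D ∧
      ∀ μ ∈ spectrum ℂ (D.map (algebraMap ℝ ℂ)), ‖μ‖ ≠ 1

/-- The curve `x ↦ (sin x, cos x, sin³ x)`. -/
def sinCurve (x : ℝ) : E3 := !₂[sin x, cos x, sin x ^ 3]

end

noncomputable section

/-! The asymptotic lines are prescribed first and the plane field is built from them. In cylindrical
coordinates, with the angle `t` as parameter, consider the curves of radius `1 + A e^t` and height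
`sin³ t + n(t) A e^t + C e^(-25t/16)`, with `n` periodic. They foliate the region `r > 1/2`, the
curve itself is `A = C = 0`, and one turn multiplies `A` by `e^(2π)` and `C` by `e^(-25π/8)`. Let
`V` be their velocity field, `W` their acceleration field and `ξ = V × W`, the normal of the
osculating planes. Differentiating `⟨ξ, V⟩ = 0` along such a curve gives `⟨dξ(V), V⟩ = -⟨ξ, W⟩ = 0`,
so every curve of the family is `ξ`-asymptotic (`inner_fderiv_fieldV_fieldV`).

On `ξ^⊥`, spanned by `V` and `W`, the quadratic form is therefore `b (a β + b κ)` at `aV + bW`,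
where `β` is `polarVW` and `κ` is `quadW`. There are no parabolic points as soon as `β ≠ 0` on the
curve, and `n` is chosen to make `β` a nonzero constant there (`polarVW_sinCurve`). Moreover `n(0) =
0`, so that `A = -y` and `C = -z` on the section `x = 0`: the Poincaré map is exactly linear and
diagonal near the origin.

The Poincaré map is only specified by continuity, so two things remain. Existence: the family is
reparametrized by the normal planes of the curve through an implicit function theorem uniform along
the period (`exists_implicit_along_segment`, `exists_isPoincareMap`). Uniqueness: an asymptotic line
whose velocity stays near `V` must be tangent to `V`, because the second factor `a β + b κ` cannot
vanish (`parallel_of_selector_ne_zero`); it then preserves `A` and `C` (`first_integrals`,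
`return_point`). -/

theorem hasDerivWithinAt_vec3 {f g h : ℝ → ℝ} {f' g' h' : ℝ} {S : Set ℝ} {x : ℝ}
    (hf : HasDerivWithinAt f f' S x) (hg : HasDerivWithinAt g g' S x)
    (hh : HasDerivWithinAt h h' S x) :
    HasDerivWithinAt (fun t => (!₂[f t, g t, h t] : E3)) !₂[f', g', h'] S x := by
  have H : HasDerivWithinAt (fun t => ![f t, g t, h t]) ![f', g', h'] S x := by
    rw [hasDerivWithinAt_pi]
    intro i
    fin_cases i
    · exact hf
    · exact hg
    · exact hh
  exact (PiLp.continuousLinearEquiv 2 ℝ (fun _ : Fin 3 => ℝ)).symm.toContinuousLinearMap.hasFDerivAt.comp_hasDerivWithinAt x H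

theorem hasDerivAt_vec3 {f g h : ℝ → ℝ} {f' g' h' : ℝ} {x : ℝ}
    (hf : HasDerivAt f f' x) (hg : HasDerivAt g g' x) (hh : HasDerivAt h h' x) :
    HasDerivAt (fun t => (!₂[f t, g t, h t] : E3)) !₂[f', g', h'] x := by
  rw [← hasDerivWithinAt_univ] at *
  exact hasDerivWithinAt_vec3 hf hg hh

/-! ### The rotating orthonormal frame. -/

/-- The vector with angular component `A`, radial component `B` and height `C`, in the
orthonormal frame `(c, -s, 0)`, `(s, c, 0)`, `(0, 0, 1)`. -/
def cyl (s c A B C : ℝ) : E3 := !₂[A * c + B * s, -(A * s) + B * c, C]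

theorem inner_cyl (s c A B C A' B' C' : ℝ) :
    inner ℝ (cyl s c A B C) (cyl s c A' B' C') =
      (s ^ 2 + c ^ 2) * (A * A' + B * B') + C * C' := by
  simp [cyl, PiLp.inner_apply, Fin.sum_univ_three]
  ring

theorem cyl_eq {s c : ℝ} (h : s ^ 2 + c ^ 2 = 1) (v : E3) :
    v = cyl s c (v 0 * c - v 1 * s) (v 0 * s + v 1 * c) (v 2) := by
  ext i
  fin_cases i
  · simp [cyl]; linear_combination -(v 0) * h
  · simp [cyl]; linear_combination -(v 1) * h
  · simp [cyl]

theorem cyl_inj {s c A B C A' B' C' : ℝ} (h : s ^ 2 + c ^ 2 = 1)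
    (e : cyl s c A B C = cyl s c A' B' C') : A = A' ∧ B = B' ∧ C = C' := by
  have e0 := congrArg (fun v : E3 => v 0) e
  have e1 := congrArg (fun v : E3 => v 1) e
  have e2 := congrArg (fun v : E3 => v 2) e
  simp only [cyl, Fin.isValue, PiLp.toLp_apply, Matrix.cons_val_zero, Matrix.cons_val_one, Matrix.cons_val] at e0 e1 e2
  refine ⟨?_, ?_, e2⟩
  · linear_combination c * e0 - s * e1 - (A - A') * h
  · linear_combination s * e0 + c * e1 - (B - B') * h

/-! ### The direction field, the acceleration field and the plane field. -/

/-- The second derivative of `sin³`, as a polynomial in sine and cosine. -/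
def curvP (s c : ℝ) : ℝ := 6 * s * c ^ 2 - 3 * s ^ 3

/-- The shear of the family of curves. -/
def shearP (s c : ℝ) : ℝ :=
  -curvP s c + 7872 / 3985 * (c ^ 3 - 3 * s ^ 2 * c - 1) + 9216 / 3985 * (3 * c ^ 2 * s - s ^ 3)

/-- The derivative of the shear with respect to the angle. -/
def dshearP (s c : ℝ) : ℝ :=
  -(6 * c ^ 3 - 21 * s ^ 2 * c) - 3 * (7872 / 3985) * (3 * c ^ 2 * s - s ^ 3) +
    3 * (9216 / 3985) * (c ^ 3 - 3 * s ^ 2 * c)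

/-- The coefficient coupling the height to the radius. -/
def coupP (s c : ℝ) : ℝ := dshearP s c + 41 / 16 * shearP s c

/-- The derivative of `coupP` with respect to the angle. -/
def dcoupP (s c : ℝ) : ℝ :=
  15 * s ^ 3 - 48 * s * c ^ 2 - 41 / 16 * (6 * c ^ 3 - 21 * s ^ 2 * c)

/-- This identity dictates the constants in `shearP`. The right side is the coupling that makes
`polarVW` constant along the curve. Writing the shear as `-curvP + a (cos 3t - 1) + b sin 3t`, the
equation `n' + (41/16) n = coupP` (where `41/16 = 1 + 25/16`) becomes `3b + (41/16)a = 12` and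
`(41/16)b = 3a`, whence `a = 7872/3985` and `b = 9216/3985`. The `-1` gives the shear the value zero
at angle `0`. -/
theorem coupP_eq (s c : ℝ) : coupP s c =
    6 * c ^ 3 - 15 * s ^ 2 * c - 41 / 16 * curvP s c - 41 / 16 * (7872 / 3985) := by
  simp only [coupP, dshearP, shearP, curvP]
  ring

/-- Height component of the direction field. -/
def velP (s c u w : ℝ) : ℝ := 3 * s ^ 2 * c - 25 / 16 * w + coupP s c * u

/-- Height component of the acceleration of the flow lines. -/
def accP (s c u w : ℝ) : ℝ :=
  curvP s c + (25 / 16) ^ 2 * w + (-(25 / 16) * coupP s c + dcoupP s c + coupP s c) * u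

/-- The distance to the vertical axis, smoothed near the axis. -/
def rad (p : E3) : ℝ :=
  √(p 0 ^ 2 + p 1 ^ 2 + smoothTransition (1 - 4 * (p 0 ^ 2 + p 1 ^ 2)))

/-- Sine of the angle, smoothed near the axis. -/
def sn (p : E3) : ℝ := p 0 / rad p

/-- Cosine of the angle, smoothed near the axis. -/
def cs (p : E3) : ℝ := p 1 / rad p

theorem rad_arg_pos (p : E3) :
    0 < p 0 ^ 2 + p 1 ^ 2 + smoothTransition (1 - 4 * (p 0 ^ 2 + p 1 ^ 2)) := by
  have h0 := smoothTransition.nonneg (1 - 4 * (p 0 ^ 2 + p 1 ^ 2))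
  by_cases h : 0 < p 0 ^ 2 + p 1 ^ 2
  · linarith
  · have := smoothTransition.pos_of_pos (x := 1 - 4 * (p 0 ^ 2 + p 1 ^ 2)) (by linarith)
    nlinarith [sq_nonneg (p 0), sq_nonneg (p 1)]

theorem rad_pos (p : E3) : 0 < rad p := Real.sqrt_pos.2 (rad_arg_pos p)

theorem contDiff_coord (i : Fin 3) : ContDiff ℝ ∞ (fun p : E3 => p i) :=
  (contDiff_euclidean.1 contDiff_id) i

@[fun_prop]
theorem contDiff_rad : ContDiff ℝ ∞ rad := by
  have h0 := contDiff_coord 0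
  have h1 := contDiff_coord 1
  refine ContDiff.sqrt ?_ fun p => (rad_arg_pos p).ne'
  have h : ContDiff ℝ ∞ (fun p : E3 => 1 - 4 * (p 0 ^ 2 + p 1 ^ 2)) := by fun_prop
  exact ((h0.pow 2).add (h1.pow 2)).add (smoothTransition.contDiff.comp h)

@[fun_prop]
theorem contDiff_sn : ContDiff ℝ ∞ sn :=
  (contDiff_coord 0).div contDiff_rad fun p => (rad_pos p).ne'

@[fun_prop]
theorem contDiff_cs : ContDiff ℝ ∞ cs :=
  (contDiff_coord 1).div contDiff_rad fun p => (rad_pos p).ne'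

/-- Deviation of the height of a point from the height of the curve. -/
def dev (p : E3) : ℝ := p 2 - sn p ^ 3

/-- Height component of the direction field at a point. -/
def vel (p : E3) : ℝ := velP (sn p) (cs p) (rad p - 1) (dev p)

/-- Height component of the acceleration at a point. -/
def acc (p : E3) : ℝ := accP (sn p) (cs p) (rad p - 1) (dev p)

/-- The direction field of the family of curves. -/
def fieldV (p : E3) : E3 := cyl (sn p) (cs p) (rad p) (rad p - 1) (vel p)

/-- The acceleration field of the family of curves. -/
def fieldW (p : E3) : E3 := cyl (sn p) (cs p) (2 * (rad p - 1)) (-1) (acc p)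

/-- The normal field of the osculating planes of the family of curves. -/
def fieldXi (p : E3) : E3 :=
  cyl (sn p) (cs p) ((rad p - 1) * acc p + vel p) (2 * (rad p - 1) * vel p - rad p * acc p)
    (-(rad p) - 2 * (rad p - 1) ^ 2)

@[fun_prop]
theorem contDiff_dev : ContDiff ℝ ∞ dev := (contDiff_coord 2).sub (contDiff_sn.pow 3)

@[fun_prop]
theorem contDiff_vel : ContDiff ℝ ∞ vel := by
  unfold vel velP coupP dshearP shearP curvP
  fun_prop

@[fun_prop]
theorem contDiff_acc : ContDiff ℝ ∞ acc := by
  unfold acc accP dcoupP coupP dshearP shearP curvP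
  fun_prop

theorem contDiff_cyl {f : E3 → ℝ} {g h k l : E3 → ℝ} (hf : ContDiff ℝ ∞ f) (hg : ContDiff ℝ ∞ g)
    (hh : ContDiff ℝ ∞ h) (hk : ContDiff ℝ ∞ k) (hl : ContDiff ℝ ∞ l) :
    ContDiff ℝ ∞ (fun p => cyl (f p) (g p) (h p) (k p) (l p)) := by
  rw [contDiff_euclidean]
  intro i
  fin_cases i
  · simp [cyl]; fun_prop
  · simp [cyl]; fun_prop
  · simpa [cyl] using hl

theorem contDiff_fieldV : ContDiff ℝ ∞ fieldV :=
  contDiff_cyl contDiff_sn contDiff_cs (by fun_prop) (by fun_prop) (by fun_prop)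

theorem contDiff_fieldW : ContDiff ℝ ∞ fieldW :=
  contDiff_cyl contDiff_sn contDiff_cs (by fun_prop) (by fun_prop) (by fun_prop)

theorem contDiff_fieldXi : ContDiff ℝ ∞ fieldXi :=
  contDiff_cyl contDiff_sn contDiff_cs (by fun_prop) (by fun_prop) (by fun_prop)

/-- This is the vertical component of `V × W`. Its sign uses only `rad > 0`, so the field vanishes
nowhere, even near the axis where the frame is no longer orthonormal. -/
theorem fieldXi_two_neg (p : E3) : -(rad p) - 2 * (rad p - 1) ^ 2 < 0 := by
  nlinarith [rad_pos p, sq_nonneg (rad p - 1)]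

theorem isPlaneField_fieldXi : IsPlaneField ∞ fieldXi := by
  refine ⟨contDiff_fieldXi, fun p h => ?_⟩
  have := congrArg (fun v : E3 => v 2) h
  simp [fieldXi, cyl] at this
  linarith [fieldXi_two_neg p]

/-! ### Cylindrical coordinates and the flow lines. -/

/-- The point with cylindrical coordinates `r`, `t`, `z`. -/
def pt (r t z : ℝ) : E3 := !₂[r * sin t, r * cos t, z]

theorem rad_pt {r : ℝ} (hr : 1 / 2 < r) (t z : ℝ) : rad (pt r t z) = r := by
  have h : (r * sin t) ^ 2 + (r * cos t) ^ 2 = r ^ 2 := by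
    linear_combination r ^ 2 * sin_sq_add_cos_sq t
  simp only [rad, pt, Fin.isValue, PiLp.toLp_apply, Matrix.cons_val_zero, Matrix.cons_val_one, h]
  -- For `r > 1/2` the argument `1 - 4r²` is negative, so the smoothing term is absent.
  rw [smoothTransition.zero_of_nonpos (by nlinarith), add_zero, Real.sqrt_sq (by linarith)]

theorem sn_pt {r : ℝ} (hr : 1 / 2 < r) (t z : ℝ) : sn (pt r t z) = sin t := by
  rw [sn, rad_pt hr]
  simp only [pt, Fin.isValue, PiLp.toLp_apply, Matrix.cons_val_zero]
  field_simp

theorem cs_pt {r : ℝ} (hr : 1 / 2 < r) (t z : ℝ) : cs (pt r t z) = cos t := by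
  rw [cs, rad_pt hr]
  simp only [pt, Fin.isValue, PiLp.toLp_apply, Matrix.cons_val_one, Matrix.cons_val_zero]
  field_simp

theorem dev_pt {r : ℝ} (hr : 1 / 2 < r) (t z : ℝ) : dev (pt r t z) = z - sin t ^ 3 := by
  rw [dev, sn_pt hr]
  simp [pt]

theorem vel_pt {r : ℝ} (hr : 1 / 2 < r) (t z : ℝ) :
    vel (pt r t z) = velP (sin t) (cos t) (r - 1) (z - sin t ^ 3) := by
  rw [vel, sn_pt hr, cs_pt hr, rad_pt hr, dev_pt hr]

theorem acc_pt {r : ℝ} (hr : 1 / 2 < r) (t z : ℝ) :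
    acc (pt r t z) = accP (sin t) (cos t) (r - 1) (z - sin t ^ 3) := by
  rw [acc, sn_pt hr, cs_pt hr, rad_pt hr, dev_pt hr]

theorem hasDerivAt_shear (t : ℝ) :
    HasDerivAt (fun t => shearP (sin t) (cos t)) (dshearP (sin t) (cos t)) t := by
  have hs := hasDerivAt_sin t
  have hc := hasDerivAt_cos t
  unfold shearP curvP
  refine HasDerivAt.congr_deriv (((((hs.const_mul 6).mul (hc.pow 2)).sub
    ((hs.pow 3).const_mul 3)).neg.add ((((hc.pow 3).sub (((hs.pow 2).const_mul 3).mul hc)).sub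
      (hasDerivAt_const t 1)).const_mul (7872 / 3985))).add
      ((((hc.pow 2).const_mul 3).mul hs).sub (hs.pow 3) |>.const_mul (9216 / 3985))) ?_
  simp only [dshearP]
  push_cast
  simp only [Pi.pow_apply]
  ring

theorem hasDerivAt_coup (t : ℝ) :
    HasDerivAt (fun t => coupP (sin t) (cos t)) (dcoupP (sin t) (cos t)) t := by
  have hs := hasDerivAt_sin t
  have hc := hasDerivAt_cos t
  simp only [coupP_eq]
  unfold curvP
  refine HasDerivAt.congr_deriv (((((hc.pow 3).const_mul 6).sub
    (((hs.pow 2).const_mul 15).mul hc)).sub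
    ((((hs.const_mul 6).mul (hc.pow 2)).sub ((hs.pow 3).const_mul 3)).const_mul (41 / 16))).sub
      (hasDerivAt_const t (41 / 16 * (7872 / 3985)))) ?_
  simp only [dcoupP]
  push_cast
  simp only [Pi.pow_apply]
  ring

/-- Radius of the flow line with parameter `A`. -/
def flowR (A t : ℝ) : ℝ := 1 + A * exp t

/-- Height of the flow line with parameters `A`, `C`. -/
def flowZ (A C t : ℝ) : ℝ :=
  sin t ^ 3 + shearP (sin t) (cos t) * (A * exp t) + C * exp (-(25 / 16) * t)

/-- The flow line with parameters `A`, `C`. -/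
def flow (A C t : ℝ) : E3 := pt (flowR A t) t (flowZ A C t)

theorem hasDerivAt_flowR (A t : ℝ) : HasDerivAt (flowR A) (flowR A t - 1) t := by
  refine HasDerivAt.congr_deriv (((Real.hasDerivAt_exp t).const_mul A).const_add 1) ?_
  simp [flowR]

/-- Height speed along a flow line. -/
def flowV (A C t : ℝ) : ℝ :=
  velP (sin t) (cos t) (flowR A t - 1) (flowZ A C t - sin t ^ 3)

theorem hasDerivAt_flowZ (A C t : ℝ) : HasDerivAt (flowZ A C) (flowV A C t) t := by
  refine HasDerivAt.congr_deriv ((((hasDerivAt_sin t).pow 3).add ((hasDerivAt_shear t).mul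
    ((Real.hasDerivAt_exp t).const_mul A))).add
    ((((hasDerivAt_id t).const_mul (-(25 / 16 : ℝ))).exp).const_mul C)) ?_
  simp only [flowV, velP, flowR, flowZ, coupP]
  push_cast
  simp
  ring

theorem hasDerivAt_flowV (A C t : ℝ) : HasDerivAt (flowV A C)
    (accP (sin t) (cos t) (flowR A t - 1) (flowZ A C t - sin t ^ 3)) t := by
  have hs := hasDerivAt_sin t
  have hc := hasDerivAt_cos t
  have hz := hasDerivAt_flowZ A C t
  have hr := hasDerivAt_flowR A t
  unfold flowV velP
  refine HasDerivAt.congr_deriv (((((hs.pow 2).const_mul 3).mul hc).sub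
    ((hz.sub (hs.pow 3)).const_mul (25 / 16))).add ((hasDerivAt_coup t).mul (hr.sub_const 1))) ?_
  simp only [flowV, velP, accP, curvP]
  push_cast
  simp only [Pi.pow_apply]
  ring

theorem hasDerivAt_flow (A C t : ℝ) : HasDerivAt (flow A C)
    (cyl (sin t) (cos t) (flowR A t) (flowR A t - 1) (flowV A C t)) t := by
  have hr := hasDerivAt_flowR A t
  refine HasDerivAt.congr_deriv (hasDerivAt_vec3 (hr.mul (hasDerivAt_sin t))
    (hr.mul (hasDerivAt_cos t)) (hasDerivAt_flowZ A C t)) ?_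
  ext i
  fin_cases i <;> simp [cyl] <;> ring

theorem hasDerivAt_flow_velocity (A C t : ℝ) : HasDerivAt
    (fun t => cyl (sin t) (cos t) (flowR A t) (flowR A t - 1) (flowV A C t))
    (cyl (sin t) (cos t) (2 * (flowR A t - 1)) (-1)
      (accP (sin t) (cos t) (flowR A t - 1) (flowZ A C t - sin t ^ 3))) t := by
  have hr := hasDerivAt_flowR A t
  have hs := hasDerivAt_sin t
  have hc := hasDerivAt_cos t
  refine HasDerivAt.congr_deriv (hasDerivAt_vec3 ((hr.mul hc).add ((hr.sub_const 1).mul hs))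
    ((hr.mul hs).neg.add ((hr.sub_const 1).mul hc)) (hasDerivAt_flowV A C t)) ?_
  ext i
  fin_cases i <;> simp [cyl] <;> ring

theorem fieldV_flow {A C t : ℝ} (h : 1 / 2 < flowR A t) : fieldV (flow A C t) =
    cyl (sin t) (cos t) (flowR A t) (flowR A t - 1) (flowV A C t) := by
  rw [fieldV, flow, sn_pt h, cs_pt h, rad_pt h, vel_pt h, flowV]

theorem fieldW_flow {A C t : ℝ} (h : 1 / 2 < flowR A t) : fieldW (flow A C t) =
    cyl (sin t) (cos t) (2 * (flowR A t - 1)) (-1)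
      (accP (sin t) (cos t) (flowR A t - 1) (flowZ A C t - sin t ^ 3)) := by
  rw [fieldW, flow, sn_pt h, cs_pt h, rad_pt h, acc_pt h]

/-! ### Flow lines are asymptotic. -/

theorem sn_sq_add_cs_sq {r : ℝ} (hr : 1 / 2 < r) (t z : ℝ) :
    sn (pt r t z) ^ 2 + cs (pt r t z) ^ 2 = 1 := by
  rw [sn_pt hr, cs_pt hr, sin_sq_add_cos_sq]

theorem inner_fieldXi_fieldV {p : E3} (h : sn p ^ 2 + cs p ^ 2 = 1) :
    inner ℝ (fieldXi p) (fieldV p) = 0 := by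
  rw [fieldXi, fieldV, inner_cyl, h]
  ring

theorem inner_fieldXi_fieldW {p : E3} (h : sn p ^ 2 + cs p ^ 2 = 1) :
    inner ℝ (fieldXi p) (fieldW p) = 0 := by
  rw [fieldXi, fieldW, inner_cyl, h]
  ring

theorem differentiable_fieldXi : Differentiable ℝ fieldXi :=
  contDiff_fieldXi.differentiable (by simp)

/-- Differentiating an orthogonality relation along a curve. -/
theorem inner_fderiv_fieldXi_of_orthogonal {c v : ℝ → E3} {c' v' : E3} {t : ℝ}
    (hc : HasDerivAt c c' t) (hv : HasDerivAt v v' t)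
    (h : ∀ᶠ x in 𝓝 t, inner ℝ (fieldXi (c x)) (v x) = 0) :
    inner ℝ (fderiv ℝ fieldXi (c t) c') (v t) = -inner ℝ (fieldXi (c t)) v' := by
  have h1 := ((differentiable_fieldXi (c t)).hasFDerivAt.comp_hasDerivAt t hc).inner ℝ hv
  have h2 := (hasDerivAt_const t (0 : ℝ)).congr_of_eventuallyEq h
  have := h1.unique h2
  simp only [Function.comp] at this
  linarith

/-- Solving for the two parameters shows that the family passes through every point, so an identity
along flow lines is an identity on an open set. The same expressions reappear as first integrals. -/
theorem flow_through (r t z : ℝ) : pt r t z = flow ((r - 1) * exp (-t))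
    ((z - sin t ^ 3 - shearP (sin t) (cos t) * (r - 1)) * exp (25 / 16 * t)) t := by
  have e1 : exp (-t) * exp t = 1 := by rw [← exp_add]; simp
  have e2 : exp (25 / 16 * t) * exp (-(25 / 16) * t) = 1 := by rw [← exp_add]; simp
  have h1 : flowR ((r - 1) * exp (-t)) t = r := by
    rw [flowR]; linear_combination (r - 1) * e1
  have h2 : flowZ ((r - 1) * exp (-t))
    ((z - sin t ^ 3 - shearP (sin t) (cos t) * (r - 1)) * exp (25 / 16 * t)) t = z := by
    rw [flowZ]
    linear_combination shearP (sin t) (cos t) * (r - 1) * e1 +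
      (z - sin t ^ 3 - shearP (sin t) (cos t) * (r - 1)) * e2
  rw [flow, h1, h2]

theorem eventually_half_lt_flowR {A t : ℝ} (h : 1 / 2 < flowR A t) :
    ∀ᶠ x in 𝓝 t, 1 / 2 < flowR A x :=
  (hasDerivAt_flowR A t).continuousAt.eventually (lt_mem_nhds h)

/-- Along the flow line through the point, `V` has derivative `W`, and both are orthogonal to `ξ`;
differentiate `⟨ξ, V⟩ = 0`. -/
theorem inner_fderiv_fieldV_fieldV {r : ℝ} (hr : 1 / 2 < r) (t z : ℝ) :
    inner ℝ (fderiv ℝ fieldXi (pt r t z) (fieldV (pt r t z))) (fieldV (pt r t z)) = 0 := by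
  have hr0 := hr
  rw [← rad_pt hr t z] at hr0
  have h0 := sn_sq_add_cs_sq hr t z
  have e := flow_through r t z
  generalize (r - 1) * exp (-t) = A at e
  generalize (z - sin t ^ 3 - shearP (sin t) (cos t) * (r - 1)) * exp (25 / 16 * t) = C at e
  -- The parameters have been generalized, so the radius is recovered by projecting the equality of
  -- points on the radial direction.
  have hA : 1 / 2 < flowR A t := by
    have : r = flowR A t := by
      have e0 := congrArg (fun v : E3 => v 0 * sin t + v 1 * cos t) e
      simp only [flow, pt, Fin.isValue, PiLp.toLp_apply, Matrix.cons_val_zero,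
        Matrix.cons_val_one] at e0
      linear_combination e0 + (flowR A t - r) * sin_sq_add_cos_sq t
    rwa [← this]
  rw [e] at h0 ⊢
  have key := inner_fderiv_fieldXi_of_orthogonal (hasDerivAt_flow A C t)
    (hasDerivAt_flow_velocity A C t) (by
      filter_upwards [eventually_half_lt_flowR hA] with x hx
      rw [← fieldV_flow hx]
      exact inner_fieldXi_fieldV (sn_sq_add_cs_sq hx _ _))
  rw [← fieldV_flow hA, ← fieldW_flow hA, inner_fieldXi_fieldW h0, neg_zero] at key
  exact key

/-! ### The quadratic form on the basis `V`, `W`, and the fields along the curve. -/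

/-- The polar form of the quadratic form of the plane field, on the two distinguished vectors. -/
def polarVW (p : E3) : ℝ :=
  inner ℝ (fderiv ℝ fieldXi p (fieldV p)) (fieldW p) +
    inner ℝ (fderiv ℝ fieldXi p (fieldW p)) (fieldV p)

/-- The quadratic form of the plane field on the acceleration. -/
def quadW (p : E3) : ℝ := inner ℝ (fderiv ℝ fieldXi p (fieldW p)) (fieldW p)

theorem continuous_fderiv_fieldXi : Continuous (fderiv ℝ fieldXi) :=
  contDiff_fieldXi.continuous_fderiv (by simp)

theorem continuous_polarVW : Continuous polarVW := by
  have h := continuous_fderiv_fieldXi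
  have h1 := contDiff_fieldV.continuous
  have h2 := contDiff_fieldW.continuous
  exact ((h.clm_apply h1).inner h2).add ((h.clm_apply h2).inner h1)

theorem continuous_quadW : Continuous quadW :=
  (continuous_fderiv_fieldXi.clm_apply contDiff_fieldW.continuous).inner
    contDiff_fieldW.continuous

theorem sinCurve_eq_pt (t : ℝ) : sinCurve t = pt 1 t (sin t ^ 3) := by
  simp [sinCurve, pt]

theorem sinCurve_eq_flow : sinCurve = flow 0 0 := by
  ext t
  simp [sinCurve_eq_pt, flow, flowR, flowZ]

theorem fieldV_sinCurve (t : ℝ) :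
    fieldV (sinCurve t) = cyl (sin t) (cos t) 1 0 (3 * sin t ^ 2 * cos t) := by
  rw [sinCurve_eq_pt, fieldV, sn_pt one_half_lt_one, cs_pt one_half_lt_one,
    rad_pt one_half_lt_one, vel_pt one_half_lt_one, velP]
  congr 1 <;> ring

theorem fieldW_sinCurve (t : ℝ) :
    fieldW (sinCurve t) = cyl (sin t) (cos t) 0 (-1) (curvP (sin t) (cos t)) := by
  rw [sinCurve_eq_pt, fieldW, sn_pt one_half_lt_one, cs_pt one_half_lt_one,
    rad_pt one_half_lt_one, acc_pt one_half_lt_one, accP]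
  congr 1 <;> ring

theorem fieldXi_sinCurve (t : ℝ) : fieldXi (sinCurve t) =
    cyl (sin t) (cos t) (3 * sin t ^ 2 * cos t) (-curvP (sin t) (cos t)) (-1) := by
  rw [sinCurve_eq_pt, fieldXi, sn_pt one_half_lt_one, cs_pt one_half_lt_one,
    rad_pt one_half_lt_one, acc_pt one_half_lt_one, vel_pt one_half_lt_one, accP, velP]
  congr 1 <;> ring

theorem hasDerivAt_sinCurve (t : ℝ) : HasDerivAt sinCurve (fieldV (sinCurve t)) t := by
  have h := hasDerivAt_flow 0 0 t
  rw [← fieldV_flow (by norm_num [flowR])] at h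
  rwa [sinCurve_eq_flow]

theorem hasDerivAt_fieldV_sinCurve (t : ℝ) :
    HasDerivAt (fun x => fieldV (sinCurve x)) (fieldW (sinCurve t)) t := by
  have h := hasDerivAt_flow_velocity 0 0 t
  rw [← fieldW_flow (by norm_num [flowR])] at h
  rw [sinCurve_eq_flow]
  refine h.congr_of_eventuallyEq (Filter.Eventually.of_forall fun x => ?_)
  exact fieldV_flow (by norm_num [flowR])

theorem hasDerivAt_curv (t : ℝ) : HasDerivAt (fun t => curvP (sin t) (cos t))
    (6 * cos t ^ 3 - 21 * sin t ^ 2 * cos t) t := by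
  have hs := hasDerivAt_sin t
  have hc := hasDerivAt_cos t
  unfold curvP
  refine HasDerivAt.congr_deriv
    (((hs.const_mul 6).mul (hc.pow 2)).sub ((hs.pow 3).const_mul 3)) ?_
  push_cast
  simp only [Pi.pow_apply]
  ring

theorem hasDerivAt_fieldW_sinCurve (t : ℝ) : HasDerivAt (fun x => fieldW (sinCurve x))
    (cyl (sin t) (cos t) (-1) 0 (6 * cos t ^ 3 - 21 * sin t ^ 2 * cos t)) t := by
  simp only [fieldW_sinCurve]
  refine HasDerivAt.congr_deriv (hasDerivAt_vec3
    (((hasDerivAt_cos t).const_mul 0).add ((hasDerivAt_sin t).const_mul (-1)))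
    (((hasDerivAt_sin t).const_mul 0).neg.add ((hasDerivAt_cos t).const_mul (-1)))
    (hasDerivAt_curv t)) ?_
  ext i
  fin_cases i <;> simp [cyl]

theorem hasDerivAt_third_sinCurve (t : ℝ) : HasDerivAt
    (fun t => cyl (sin t) (cos t) (-1) 0 (6 * cos t ^ 3 - 21 * sin t ^ 2 * cos t))
    (cyl (sin t) (cos t) 0 1 (21 * sin t ^ 3 - 60 * sin t * cos t ^ 2)) t := by
  have hs := hasDerivAt_sin t
  have hc := hasDerivAt_cos t
  refine HasDerivAt.congr_deriv (hasDerivAt_vec3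
    ((hc.const_mul (-1)).add (hs.const_mul 0))
    ((hs.const_mul (-1)).neg.add (hc.const_mul 0))
    (((hc.pow 3).const_mul 6).sub (((hs.pow 2).const_mul 21).mul hc))) ?_
  ext i
  fin_cases i <;> simp [cyl]
  ring

/-! ### Derivatives of the curve and finite type. -/

theorem deriv_sinCurve : deriv sinCurve = fun x => fieldV (sinCurve x) :=
  funext fun t => (hasDerivAt_sinCurve t).deriv

theorem iteratedDeriv_two_sinCurve :
    iteratedDeriv 2 sinCurve = fun x => fieldW (sinCurve x) := by
  rw [iteratedDeriv_succ, iteratedDeriv_one, deriv_sinCurve]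
  exact funext fun t => (hasDerivAt_fieldV_sinCurve t).deriv

theorem iteratedDeriv_three_sinCurve : iteratedDeriv 3 sinCurve =
    fun t => cyl (sin t) (cos t) (-1) 0 (6 * cos t ^ 3 - 21 * sin t ^ 2 * cos t) := by
  rw [iteratedDeriv_succ, iteratedDeriv_two_sinCurve]
  exact funext fun t => (hasDerivAt_fieldW_sinCurve t).deriv

theorem iteratedDeriv_four_sinCurve : iteratedDeriv 4 sinCurve =
    fun t => cyl (sin t) (cos t) 0 1 (21 * sin t ^ 3 - 60 * sin t * cos t ^ 2) := by
  rw [iteratedDeriv_succ, iteratedDeriv_three_sinCurve]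
  exact funext fun t => (hasDerivAt_third_sinCurve t).deriv

theorem smul_cyl (a s c A B C : ℝ) : a • cyl s c A B C = cyl s c (a * A) (a * B) (a * C) := by
  ext i
  fin_cases i <;> simp [cyl] <;> ring

theorem add_cyl (s c A B C A' B' C' : ℝ) :
    cyl s c A B C + cyl s c A' B' C' = cyl s c (A + A') (B + B') (C + C') := by
  ext i
  fin_cases i <;> simp [cyl] <;> ring

/-- A subspace which contains a vertical vector and two vectors with independent horizontal
projections is the whole space. -/
theorem eq_top_of_cyl_mem {s c a b d : ℝ} (h : s ^ 2 + c ^ 2 = 1) (hd : d ≠ 0)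
    {M : Submodule ℝ E3} (h1 : cyl s c 1 0 a ∈ M) (h2 : cyl s c 0 (-1) b ∈ M)
    (h3 : cyl s c 0 0 d ∈ M) : M = ⊤ := by
  rw [eq_top_iff]
  intro v _
  have : v = (v 0 * c - v 1 * s) • cyl s c 1 0 a + (-(v 0 * s + v 1 * c)) • cyl s c 0 (-1) b +
      ((v 2 - (v 0 * c - v 1 * s) * a + (v 0 * s + v 1 * c) * b) / d) • cyl s c 0 0 d := by
    conv_lhs => rw [cyl_eq h v]
    rw [smul_cyl, smul_cyl, smul_cyl, add_cyl, add_cyl]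
    congr 1
    · ring
    · ring
    · field_simp
      ring
  rw [this]
  exact M.add_mem (M.add_mem (M.smul_mem _ h1) (M.smul_mem _ h2)) (M.smul_mem _ h3)

/-- The horizontal part is a unit circle, so `γ' + γ'''` and `γ'' + γ''''` are vertical, with
heights `6 cos 3t` and `-18 sin 3t`. These never vanish together, and `γ'`, `γ''` supply the
horizontal directions. -/
theorem isFiniteTypeAt_sinCurve (t : ℝ) : IsFiniteTypeAt sinCurve t := by
  refine ⟨4, ?_⟩
  have hsc := sin_sq_add_cos_sq t
  set M := Submodule.span ℝ {v : E3 | ∃ j : ℕ, 1 ≤ j ∧ j ≤ 4 ∧ v = iteratedDeriv j sinCurve t}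
  have hM : ∀ j : ℕ, 1 ≤ j → j ≤ 4 → iteratedDeriv j sinCurve t ∈ M := fun j h1 h2 =>
    Submodule.subset_span ⟨j, h1, h2, rfl⟩
  have m1 := hM 1 (by norm_num) (by norm_num)
  have m2 := hM 2 (by norm_num) (by norm_num)
  have m3 := hM 3 (by norm_num) (by norm_num)
  have m4 := hM 4 (by norm_num) (by norm_num)
  rw [iteratedDeriv_one, deriv_sinCurve] at m1
  rw [iteratedDeriv_two_sinCurve] at m2
  rw [iteratedDeriv_three_sinCurve] at m3
  rw [iteratedDeriv_four_sinCurve] at m4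
  simp only [fieldV_sinCurve, fieldW_sinCurve] at m1 m2 m3 m4
  by_cases h : cos t ^ 3 - 3 * sin t ^ 2 * cos t = 0
  · refine eq_top_of_cyl_mem hsc (d := 18 * (sin t ^ 3 - 3 * sin t * cos t ^ 2)) ?_ m1 m2 ?_
    · intro h'
      have : (cos t ^ 3 - 3 * sin t ^ 2 * cos t) ^ 2 + (sin t ^ 3 - 3 * sin t * cos t ^ 2) ^ 2
          = 1 := by
        calc _ = (sin t ^ 2 + cos t ^ 2) ^ 3 := by ring
          _ = 1 := by rw [hsc]; norm_num
      rw [h, (mul_eq_zero.1 h').resolve_left (by norm_num)] at this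
      norm_num at this
    · have := M.add_mem m4 m2
      rw [add_cyl] at this
      convert this using 2
      · ring
      · ring
      · rw [curvP]; ring
  · refine eq_top_of_cyl_mem hsc (d := 6 * (cos t ^ 3 - 3 * sin t ^ 2 * cos t))
      (mul_ne_zero (by norm_num) h) m1 m2 ?_
    have := M.add_mem m3 m1
    rw [add_cyl] at this
    convert this using 2 <;> ring

theorem contDiff_sinCurve : ContDiff ℝ ∞ sinCurve := by
  rw [contDiff_euclidean]
  intro i
  fin_cases i
  · exact contDiff_sin
  · exact contDiff_cos
  · exact contDiff_sin.pow 3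

theorem fieldV_sinCurve_ne_zero (t : ℝ) : fieldV (sinCurve t) ≠ 0 := by
  intro h
  have : cyl (sin t) (cos t) 1 0 (3 * sin t ^ 2 * cos t) = cyl (sin t) (cos t) 0 0 0 := by
    rw [← fieldV_sinCurve, h]
    ext i
    fin_cases i <;> simp [cyl]
  exact one_ne_zero (cyl_inj (sin_sq_add_cos_sq t) this).1

theorem isFiniteTypeCurve_sinCurve : IsFiniteTypeCurve sinCurve := by
  refine ⟨contDiff_sinCurve, fun t => ?_, isFiniteTypeAt_sinCurve⟩
  rw [deriv_sinCurve]
  exact fieldV_sinCurve_ne_zero t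

theorem hasLocallyConvexProjection_sinCurve : HasLocallyConvexProjection sinCurve := by
  intro t
  have hsc := sin_sq_add_cos_sq t
  rw [deriv_sinCurve, iteratedDeriv_two_sinCurve]
  simp only [fieldV_sinCurve, fieldW_sinCurve]
  simp only [cyl, Fin.isValue, PiLp.toLp_apply, Matrix.cons_val_zero, Matrix.cons_val_one]
  constructor
  · by_contra! h
    nlinarith
  · nlinarith

theorem periodic_sinCurve : Function.Periodic sinCurve (2 * π) := by
  intro t
  simp [sinCurve]

/-! ### The curve is asymptotic and has no parabolic points. -/

theorem sn_sq_add_cs_sq_sinCurve (t : ℝ) :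
    sn (sinCurve t) ^ 2 + cs (sinCurve t) ^ 2 = 1 := by
  rw [sinCurve_eq_pt]
  exact sn_sq_add_cs_sq one_half_lt_one _ _

theorem isAsymptoticDirection_fieldV_sinCurve (t : ℝ) :
    IsAsymptoticDirection fieldXi (sinCurve t) (fieldV (sinCurve t)) := by
  refine ⟨fieldV_sinCurve_ne_zero t, inner_fieldXi_fieldV (sn_sq_add_cs_sq_sinCurve t), ?_⟩
  rw [sinCurve_eq_pt]
  exact inner_fderiv_fieldV_fieldV one_half_lt_one _ _

theorem isClosedAsymptoticLine_sinCurve :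
    IsClosedAsymptoticLine fieldXi sinCurve (2 * π) := by
  refine ⟨by positivity, periodic_sinCurve, (contDiff_sinCurve.of_le (by simp)).contDiffOn,
    fun t _ => ?_⟩
  rw [derivWithin_univ, deriv_sinCurve]
  exact isAsymptoticDirection_fieldV_sinCurve t

/-- Both terms are reduced to values of `ξ` by differentiating an orthogonality: `⟨dξ(V), W⟩ = -⟨ξ,
dW(V)⟩` along the curve, and `⟨dξ(W), V⟩ = -⟨ξ, dV(W)⟩` along a segment in direction `W`. The sum
depends on the shear only through `coupP`, which cancels the variable part. -/
theorem polarVW_sinCurve (t : ℝ) : polarVW (sinCurve t) = 41 / 16 * (7872 / 3985) := by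
  have hsc := sin_sq_add_cos_sq t
  have k1 := inner_fderiv_fieldXi_of_orthogonal (hasDerivAt_sinCurve t)
    (hasDerivAt_fieldW_sinCurve t)
    (Filter.Eventually.of_forall fun x => inner_fieldXi_fieldW (sn_sq_add_cs_sq_sinCurve x))
  have hx := hasDerivAt_id (0 : ℝ)
  -- On the curve `W` has no angular component, so this segment keeps the angle fixed and `V` is
  -- explicit along it.
  have hc : HasDerivAt (fun x => pt (1 - x) t (sin t ^ 3 + x * curvP (sin t) (cos t)))
      (fieldW (sinCurve t)) 0 := by
    refine HasDerivAt.congr_deriv (hasDerivAt_vec3 ((hx.const_sub 1).mul_const (sin t))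
      ((hx.const_sub 1).mul_const (cos t))
      ((hx.mul_const (curvP (sin t) (cos t))).const_add (sin t ^ 3))) ?_
    rw [fieldW_sinCurve]
    ext i
    fin_cases i <;> simp [cyl]
  have hv : HasDerivAt (fun x => cyl (sin t) (cos t) (1 - x) (-x)
      (velP (sin t) (cos t) (-x) (x * curvP (sin t) (cos t))))
      (cyl (sin t) (cos t) (-1) (-1)
        (-(25 / 16) * curvP (sin t) (cos t) - coupP (sin t) (cos t))) 0 := by
    refine HasDerivAt.congr_deriv (hasDerivAt_vec3
      (((hx.const_sub 1).mul_const (cos t)).add (hx.neg.mul_const (sin t)))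
      (((hx.const_sub 1).mul_const (sin t)).neg.add (hx.neg.mul_const (cos t)))
      ((((hx.mul_const (curvP (sin t) (cos t))).const_mul (25 / 16)).const_sub
        (3 * sin t ^ 2 * cos t)).add (hx.neg.const_mul (coupP (sin t) (cos t))))) ?_
    ext i
    fin_cases i <;> simp [cyl]
    ring
  have k2 := inner_fderiv_fieldXi_of_orthogonal hc hv (by
    filter_upwards [gt_mem_nhds (show (0 : ℝ) < 1 / 2 by norm_num)] with x hx
    have hr : 1 / 2 < 1 - x := by linarith
    have e := inner_fieldXi_fieldV
      (sn_sq_add_cs_sq hr t (sin t ^ 3 + x * curvP (sin t) (cos t)))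
    rw [fieldV, sn_pt hr, cs_pt hr, rad_pt hr, vel_pt hr] at e
    rw [← e]
    congr 2
    · ring
    · congr 1 <;> ring)
  have e0 : pt (1 - 0) t (sin t ^ 3 + 0 * curvP (sin t) (cos t)) = sinCurve t := by
    rw [sinCurve_eq_pt]; congr 1 <;> ring
  have e1 : cyl (sin t) (cos t) (1 - 0) (-0)
      (velP (sin t) (cos t) (-0) (0 * curvP (sin t) (cos t))) = fieldV (sinCurve t) := by
    rw [fieldV_sinCurve, velP]; congr 1 <;> ring
  rw [e0, e1, fieldXi_sinCurve, inner_cyl, hsc] at k2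
  rw [fieldXi_sinCurve, inner_cyl, hsc] at k1
  rw [polarVW, k1, k2, coupP_eq]
  ring

theorem inner_fderiv_combination {p : E3}
    (h : inner ℝ (fderiv ℝ fieldXi p (fieldV p)) (fieldV p) = 0) (a b : ℝ) :
    inner ℝ (fderiv ℝ fieldXi p (a • fieldV p + b • fieldW p)) (a • fieldV p + b • fieldW p) =
      b * (a * polarVW p + b * quadW p) := by
  simp only [map_add, map_smul, inner_add_left, inner_add_right, real_inner_smul_left,
    real_inner_smul_right, h, polarVW, quadW]
  ring

theorem not_isParabolicPoint_sinCurve (t : ℝ) : ¬ IsParabolicPoint fieldXi (sinCurve t) := by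
  have hsc := sin_sq_add_cos_sq t
  have h0 := isAsymptoticDirection_fieldV_sinCurve t
  have hB := polarVW_sinCurve t
  have key := inner_fderiv_combination h0.2.2
  have horth : ∀ a b : ℝ,
      inner ℝ (fieldXi (sinCurve t)) (a • fieldV (sinCurve t) + b • fieldW (sinCurve t)) = 0 := by
    intro a b
    rw [inner_add_right, real_inner_smul_right, real_inner_smul_right, h0.2.1,
      inner_fieldXi_fieldW (sn_sq_add_cs_sq_sinCurve t)]
    ring
  have hindep : ∀ a b a' b' : ℝ, a • fieldV (sinCurve t) + b • fieldW (sinCurve t) =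
      a' • fieldV (sinCurve t) + b' • fieldW (sinCurve t) → a = a' ∧ b = b' := by
    intro a b a' b' h
    simp only [fieldV_sinCurve, fieldW_sinCurve, smul_cyl, add_cyl] at h
    obtain ⟨h1, h2, -⟩ := cyl_inj hsc h
    constructor <;> linarith
  have hne : ∀ a b : ℝ, b ≠ 0 → a • fieldV (sinCurve t) + b • fieldW (sinCurve t) ≠ 0 := by
    intro a b hb h
    exact hb (hindep a b 0 0 (by rw [h]; simp)).2
  rintro (⟨v, hv, hall⟩ | hall)
  · have hb : polarVW (sinCurve t) ≠ 0 := by rw [hB]; norm_num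
    obtain ⟨x, hx⟩ := hall _ h0
    -- The zero of the second factor `a β + b κ`: an asymptotic direction independent of `V`, since
    -- its `W`-coefficient `β` is nonzero.
    obtain ⟨y, hy⟩ := hall ((-quadW (sinCurve t)) • fieldV (sinCurve t) +
      polarVW (sinCurve t) • fieldW (sinCurve t))
      ⟨hne _ _ hb, horth _ _, by rw [key]; ring⟩
    have := hindep (x * -quadW (sinCurve t)) (x * polarVW (sinCurve t)) y 0 (by
      rw [mul_smul, mul_smul, ← smul_add, hy, hx, zero_smul, add_zero, smul_comm])
    have hx0 : x = 0 := (mul_eq_zero.1 this.2).resolve_right hb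
    rw [hx0, zero_smul] at hx
    exact h0.1 hx
  · have h1 := (hall _ (hne 0 1 one_ne_zero) (horth _ _)).2.2
    have h2 := (hall _ (hne 1 1 one_ne_zero) (horth _ _)).2.2
    rw [key] at h1 h2
    rw [hB] at h1 h2
    linarith

/-! ### Existence of the Poincaré map. -/

/-- A nonzero linear endomorphism of the line is invertible. -/
theorem isInvertible_of_apply_one_ne_zero (L : ℝ →L[ℝ] ℝ) (h : L 1 ≠ 0) : L.IsInvertible := by
  refine ⟨ContinuousLinearEquiv.unitsEquivAut ℝ (Units.mk0 (L 1) h), ?_⟩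
  ext
  simp

/-- Implicit function theorem along a compact segment: a `C^1` equation `G (x, q) τ = 0` which has
the simple zero `τ = 0` for `q = 0` has a `C^1` solution for all `x` in the segment and all small
`q`, and it is the only small solution. -/
theorem exists_implicit_along_segment {Q : Type*} [NormedAddCommGroup Q] [NormedSpace ℝ Q]
    [CompleteSpace Q] {a b : ℝ} {G : (ℝ × Q) × ℝ → ℝ} (hG : ContDiff ℝ 1 G)
    (h0 : ∀ x ∈ Icc a b, G ((x, 0), 0) = 0)
    (hpos : ∀ x ∈ Icc a b, 0 < fderiv ℝ G ((x, 0), 0) (0, 1)) :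
    ∃ U : Set Q, IsOpen U ∧ 0 ∈ U ∧ ∃ T : ℝ × Q → ℝ, ∀ x ∈ Ioo a b, ∀ q ∈ U,
      ContDiffAt ℝ 1 T (x, q) ∧ G ((x, q), T (x, q)) = 0 ∧
        (G ((x, q), 0) = 0 → T (x, q) = 0) := by
  have hGd : Differentiable ℝ G := hG.differentiable (by simp)
  have hslice : ∀ z τ, HasDerivAt (fun τ => G (z, τ)) (fderiv ℝ G (z, τ) (0, 1)) τ := by
    intro z τ
    exact (hGd (z, τ)).hasFDerivAt.comp_hasDerivAt τ ((hasDerivAt_const τ z).prodMk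
      (hasDerivAt_id τ))
  have hcont : Continuous fun v => fderiv ℝ G v (0, 1) :=
    (hG.continuous_fderiv (by simp)).clm_apply continuous_const
  obtain ⟨ε, hε, hball⟩ : ∃ ε > 0, ∀ w : Q × ℝ, w ∈ Metric.ball (0 : Q × ℝ) ε →
      ∀ x ∈ Icc a b, 0 < fderiv ℝ G ((x, w.1), w.2) (0, 1) := by
    have := isCompact_Icc.eventually_forall_of_forall_eventually (x₀ := (0 : Q × ℝ))
      (K := Icc a b) (P := fun w x => 0 < fderiv ℝ G ((x, w.1), w.2) (0, 1)) (by
        intro x hx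
        have hc : Continuous fun z : (Q × ℝ) × ℝ => fderiv ℝ G ((z.2, z.1.1), z.1.2) (0, 1) :=
          hcont.comp (by fun_prop)
        exact hc.continuousAt.eventually (lt_mem_nhds (hpos x hx)))
    exact Metric.eventually_nhds_iff_ball.1 this
  set δ := ε / 2
  have hδ : 0 < δ := half_pos hε
  have hmem : ∀ q : Q, ‖q‖ < δ → ∀ τ ∈ Icc (-δ) δ, (q, τ) ∈ Metric.ball (0 : Q × ℝ) ε := by
    intro q hq τ hτ
    rw [mem_ball_zero_iff, Prod.norm_def]
    refine max_lt (hq.trans (half_lt_self hε)) ?_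
    rw [Real.norm_eq_abs]
    exact (abs_le.2 hτ).trans_lt (half_lt_self hε)
  -- Compactness has made the derivative in `τ` positive on a box of uniform size. Monotonicity
  -- gives uniqueness of the zero there, and the signs at `±δ` will give existence.
  have hmono : ∀ x ∈ Icc a b, ∀ q : Q, ‖q‖ < δ →
      StrictMonoOn (fun τ => G ((x, q), τ)) (Icc (-δ) δ) := by
    intro x hx q hq
    refine strictMonoOn_of_deriv_pos (convex_Icc _ _)
      (fun τ _ => (hslice (x, q) τ).continuousAt.continuousWithinAt) fun τ hτ => ?_
    rw [(hslice (x, q) τ).deriv]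
    exact hball (q, τ) (hmem q hq τ (interior_subset hτ)) x hx
  have hev : ∀ᶠ q : Q in 𝓝 0, ∀ x ∈ Icc a b, G ((x, q), -δ) < 0 ∧ 0 < G ((x, q), δ) := by
    refine isCompact_Icc.eventually_forall_of_forall_eventually
      (P := fun q x => G ((x, q), -δ) < 0 ∧ 0 < G ((x, q), δ)) fun x hx => ?_
    have hm := hmono x hx 0 (by simpa using hδ)
    have h1 : G ((x, 0), -δ) < 0 := by
      rw [← h0 x hx]
      exact hm ⟨le_rfl, by linarith⟩ ⟨by linarith, hδ.le⟩ (by linarith)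
    have h2 : 0 < G ((x, 0), δ) := by
      rw [← h0 x hx]
      exact hm ⟨by linarith, hδ.le⟩ ⟨by linarith, le_rfl⟩ hδ
    have c1 : Continuous fun z : Q × ℝ => G ((z.2, z.1), -δ) := hG.continuous.comp (by fun_prop)
    have c2 : Continuous fun z : Q × ℝ => G ((z.2, z.1), δ) := hG.continuous.comp (by fun_prop)
    exact (c1.continuousAt.eventually (gt_mem_nhds h1)).and
      (c2.continuousAt.eventually (lt_mem_nhds h2))
  obtain ⟨η, hη, hηb⟩ := Metric.eventually_nhds_iff_ball.1 hev
  set r := min η δ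
  have hr : 0 < r := lt_min hη hδ
  have hrδ : ∀ q ∈ Metric.ball (0 : Q) r, ‖q‖ < δ := fun q hq =>
    (mem_ball_zero_iff.1 hq).trans_le (min_le_right _ _)
  have hex : ∀ z : ℝ × Q, ∃ τ, z.1 ∈ Icc a b → z.2 ∈ Metric.ball (0 : Q) r →
      τ ∈ Ioo (-δ) δ ∧ G (z, τ) = 0 := by
    rintro ⟨x, q⟩
    by_cases hx : x ∈ Icc a b ∧ q ∈ Metric.ball (0 : Q) r
    · obtain ⟨h1, h2⟩ := hηb q (Metric.ball_subset_ball (min_le_left _ _) hx.2) x hx.1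
      obtain ⟨τ, hτ, hτ0⟩ := intermediate_value_Ioo (by linarith : -δ ≤ δ)
        (f := fun τ => G ((x, q), τ))
        (fun τ _ => (hslice (x, q) τ).continuousAt.continuousWithinAt) ⟨h1, h2⟩
      exact ⟨τ, fun _ _ => ⟨hτ, hτ0⟩⟩
    · exact ⟨0, fun h1 h2 => absurd ⟨h1, h2⟩ hx⟩
  choose T hT using hex
  have huniq : ∀ x ∈ Icc a b, ∀ q ∈ Metric.ball (0 : Q) r, ∀ τ ∈ Ioo (-δ) δ,
      G ((x, q), τ) = 0 → T (x, q) = τ := by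
    intro x hx q hq τ hτ hτ0
    obtain ⟨h1, h2⟩ := hT (x, q) hx hq
    exact (hmono x hx q (hrδ q hq)).injOn (Ioo_subset_Icc_self h1) (Ioo_subset_Icc_self hτ)
      (h2.trans hτ0.symm)
  refine ⟨Metric.ball 0 r, Metric.isOpen_ball, Metric.mem_ball_self hr, T, fun x hx q hq => ?_⟩
  have hx' := Ioo_subset_Icc_self hx
  obtain ⟨hTm, hT0⟩ := hT (x, q) hx' hq
  refine ⟨?_, hT0, fun h => huniq x hx' q hq 0 ⟨by linarith, hδ⟩ h⟩
  have hinv : (fderiv ℝ G ((x, q), T (x, q)) ∘L .inr ℝ (ℝ × Q) ℝ).IsInvertible := by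
    refine isInvertible_of_apply_one_ne_zero _ (ne_of_gt ?_)
    exact hball (q, T (x, q)) (hmem q (hrδ q hq) _ (Ioo_subset_Icc_self hTm)) x hx'
  have hc : ContDiffAt ℝ 1 G ((x, q), T (x, q)) := hG.contDiffAt
  have hψ := hc.contDiffAt_implicitFunction one_ne_zero hinv
  -- Regularity is local: by uniqueness, `T` coincides near `(x, q)` with the function of the
  -- implicit function theorem.
  refine hψ.congr_of_eventuallyEq ?_
  have e1 := hc.eventually_apply_implicitFunction one_ne_zero hinv
  have e2 : ∀ᶠ z in 𝓝 (x, q), hc.implicitFunction one_ne_zero hinv z ∈ Ioo (-δ) δ := by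
    refine hψ.continuousAt.eventually (isOpen_Ioo.mem_nhds ?_)
    have := hc.implicitFunction_apply_self one_ne_zero hinv
    dsimp only at this
    rwa [this]
  have e3 : ∀ᶠ z in 𝓝 (x, q), z ∈ Icc a b ×ˢ Metric.ball (0 : Q) r :=
    prod_mem_nhds (Icc_mem_nhds hx.1 hx.2) (Metric.isOpen_ball.mem_nhds hq)
  filter_upwards [e1, e2, e3] with z h1 h2 h3
  exact huniq z.1 h3.1 z.2 h3.2 _ h2 (h1.trans hT0)

theorem pt_add (r x t z : ℝ) :
    pt r (x + t) z = cyl (sin x) (cos x) (r * sin t) (r * cos t) z := by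
  ext i
  fin_cases i
  · simp [pt, cyl, sin_add]; ring
  · simp [pt, cyl, cos_add]; ring
  · simp [pt, cyl]

theorem tube_sinCurve (x : ℝ) (q : Fin 2 → ℝ) : tube sinCurve x q =
    cyl (sin x) (cos x) (q 1 * (3 * sin x ^ 2 * cos x)) (1 - q 0) (sin x ^ 3 - q 1) := by
  have h := sin_sq_add_cos_sq x
  simp only [tube, frameZ, frameY, frameX, deriv_sinCurve, fieldV_sinCurve]
  ext i
  fin_cases i
  · simp [cyl, sinCurve, cross_apply]; ring
  · simp [cyl, sinCurve, cross_apply]; ring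
  · simp [cyl, sinCurve, cross_apply]; linear_combination -(q 1) * h

/-- The equation expressing that the flow line with initial condition `q` meets, at the angle
`x + τ`, the plane normal to the curve at `x`. -/
def hitEq (v : (ℝ × (Fin 2 → ℝ)) × ℝ) : ℝ :=
  flowR (-(v.1.2 0)) (v.1.1 + v.2) * sin v.2 - 3 * sin v.1.1 ^ 2 * cos v.1.1 *
    (sin v.1.1 ^ 3 - flowZ (-(v.1.2 0)) (-(v.1.2 1)) (v.1.1 + v.2))

theorem contDiff_hitEq : ContDiff ℝ 1 hitEq := by
  unfold hitEq flowR flowZ shearP curvP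
  fun_prop

theorem hitEq_zero (x : ℝ) : hitEq ((x, 0), 0) = 0 := by
  simp [hitEq, flowZ]

theorem hitEq_initial (q : Fin 2 → ℝ) : hitEq ((0, q), 0) = 0 := by
  simp [hitEq]

/-- The derivative is `1 + (3 sin² x cos x)²`, the squared speed of the curve: a curve crosses its
own normal plane transversally. -/
theorem fderiv_hitEq_pos (x : ℝ) : 0 < fderiv ℝ hitEq ((x, 0), 0) (0, 1) := by
  have h1 := (contDiff_hitEq.differentiable (by simp) ((x, 0), 0)).hasFDerivAt.comp_hasDerivAt
    (0 : ℝ) ((hasDerivAt_const (0 : ℝ) (x, (0 : Fin 2 → ℝ))).prodMk (hasDerivAt_id (0 : ℝ)))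
  have hz : HasDerivAt (fun τ => flowZ 0 0 (x + τ)) (flowV 0 0 x) 0 := by
    simpa using (hasDerivAt_flowZ 0 0 (x + 0)).comp_const_add x 0
  have h2 := (hasDerivAt_sin 0).sub ((hz.const_sub (sin x ^ 3)).const_mul (3 * sin x ^ 2 * cos x))
  have h3 : hitEq ∘ Prod.mk (x, (0 : Fin 2 → ℝ)) = sin -
      fun τ => 3 * sin x ^ 2 * cos x * (sin x ^ 3 - flowZ 0 0 (x + τ)) := by
    ext τ
    simp [hitEq, flowR]
  rw [h3] at h1
  rw [h1.unique h2]
  simp only [flowV, velP, flowR, flowZ, cos_zero]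
  ring_nf
  positivity

/-- There is a family of solutions of the hitting equation. -/
theorem exists_angle : ∃ U ∈ 𝓝 (0 : Fin 2 → ℝ), ∃ T : ℝ × (Fin 2 → ℝ) → ℝ,
    ∀ x ∈ Icc 0 (2 * π), ∀ q ∈ U, ContDiffAt ℝ 1 T (x, q) ∧ hitEq ((x, q), T (x, q)) = 0 ∧
      T (0, q) = 0 ∧ T (x, 0) = 0 ∧ 1 / 2 < flowR (-(q 0)) (x + T (x, q)) ∧
      0 < 1 + fderiv ℝ T (x, q) (1, 0) := by
  -- An open interval containing `[0, 2π]`, so that `T` is differentiable in both senses at the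
  -- endpoints too.
  obtain ⟨U, hU, h0U, T, hT⟩ := exists_implicit_along_segment (a := -1) (b := 7)
    contDiff_hitEq (fun x _ => hitEq_zero x) (fun x _ => fderiv_hitEq_pos x)
  have hsub : Icc 0 (2 * π) ⊆ Ioo (-1) 7 := fun x hx =>
    ⟨by linarith [hx.1], by linarith [hx.2, pi_lt_d2]⟩
  have hTx : ∀ x ∈ Ioo (-1 : ℝ) 7, T (x, 0) = 0 := fun x hx =>
    (hT x hx 0 h0U).2.2 (hitEq_zero x)
  have hd : ∀ x ∈ Ioo (-1 : ℝ) 7, fderiv ℝ T (x, 0) (1, 0) = 0 := by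
    intro x hx
    have h1 := ((hT x hx 0 h0U).1.differentiableAt (by simp)).hasFDerivAt.comp_hasDerivAt x
      ((hasDerivAt_id x).prodMk (hasDerivAt_const x (0 : Fin 2 → ℝ)))
    refine h1.unique ((hasDerivAt_const x (0 : ℝ)).congr_of_eventuallyEq ?_)
    filter_upwards [isOpen_Ioo.mem_nhds hx] with y hy
    exact hTx y hy
  have hev := isCompact_Icc.eventually_forall_of_forall_eventually (x₀ := (0 : Fin 2 → ℝ))
    (K := Icc 0 (2 * π)) (P := fun q x => 1 / 2 < flowR (-(q 0)) (x + T (x, q)) ∧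
      0 < 1 + fderiv ℝ T (x, q) (1, 0)) (by
    intro x hx
    have hx' := hsub hx
    have hTc := (hT x hx' 0 h0U).1
    have hswap : ContinuousAt (fun z : (Fin 2 → ℝ) × ℝ => (z.2, z.1)) (0, x) := by fun_prop
    have c0 : ContinuousAt (fun z : (Fin 2 → ℝ) × ℝ => T (z.2, z.1)) (0, x) :=
      ContinuousAt.comp (x := ((0 : Fin 2 → ℝ), x)) (g := T) hTc.continuousAt hswap
    have c1 : ContinuousAt
        (fun z : (Fin 2 → ℝ) × ℝ => flowR (-(z.1 0)) (z.2 + T (z.2, z.1))) (0, x) := by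
      unfold flowR
      fun_prop
    have c2 : ContinuousAt
        (fun z : (Fin 2 → ℝ) × ℝ => 1 + fderiv ℝ T (z.2, z.1) (1, 0)) (0, x) := by
      have c3 := ContinuousAt.comp (x := ((0 : Fin 2 → ℝ), x)) (g := fderiv ℝ T)
        (hTc.fderiv_right (m := 0) (by simp)).continuousAt hswap
      exact continuousAt_const.add (c3.clm_apply continuousAt_const)
    refine (c1.eventually (lt_mem_nhds ?_)).and (c2.eventually (lt_mem_nhds ?_))
    · norm_num [flowR]
    · norm_num [hd x hx'])
  refine ⟨U ∩ {q | _}, Filter.inter_mem (hU.mem_nhds h0U) hev, T, fun x hx q hq => ?_⟩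
  obtain ⟨h1, h2, -⟩ := hT x (hsub hx) q hq.1
  obtain ⟨h3, h4⟩ := hq.2 x hx
  exact ⟨h1, h2, (hT 0 (by norm_num) q hq.1).2.2 (hitEq_initial q), hTx x (hsub hx), h3, h4⟩

theorem contDiff_flow (A C : ℝ) : ContDiff ℝ 1 (flow A C) := by
  rw [contDiff_euclidean]
  intro i
  unfold flow pt flowR flowZ shearP curvP
  fin_cases i
  · simp; fun_prop
  · simp; fun_prop
  · simp; fun_prop

theorem isAsymptoticDirection_smul_fieldV {r : ℝ} (hr : 1 / 2 < r) (t z : ℝ) {a : ℝ}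
    (ha : a ≠ 0) : IsAsymptoticDirection fieldXi (pt r t z) (a • fieldV (pt r t z)) := by
  refine ⟨smul_ne_zero ha fun h => ?_, ?_, ?_⟩
  · have : cyl (sn (pt r t z)) (cs (pt r t z)) (rad (pt r t z)) (rad (pt r t z) - 1)
        (vel (pt r t z)) = cyl (sn (pt r t z)) (cs (pt r t z)) 0 0 0 := by
      refine Eq.trans h ?_
      ext i
      fin_cases i <;> simp [cyl]
    exact (rad_pos _).ne' (cyl_inj (sn_sq_add_cs_sq hr t z) this).1
  · rw [real_inner_smul_right, inner_fieldXi_fieldV (sn_sq_add_cs_sq hr t z), mul_zero]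
  · rw [map_smul, real_inner_smul_left, real_inner_smul_right,
      inner_fderiv_fieldV_fieldV hr, mul_zero, mul_zero]

theorem exists_isPoincareMap : ∃ P, IsPoincareMap fieldXi sinCurve (2 * π) P := by
  obtain ⟨U, hU, T, hT⟩ := exists_angle
  -- The transversal coordinates of the point where the flow line with `A = -y₀`, `C = -z₀` meets
  -- the normal plane at `x`. The angular coordinate matches because of `hitEq`.
  let φ : ℝ → (Fin 2 → ℝ) → (Fin 2 → ℝ) := fun x q =>
    ![1 - flowR (-(q 0)) (x + T (x, q)) * cos (T (x, q)),
      sin x ^ 3 - flowZ (-(q 0)) (-(q 1)) (x + T (x, q))]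
  have hpi : (0 : ℝ) ∈ Icc 0 (2 * π) := ⟨le_rfl, by positivity⟩
  have hφ : ∀ z ∈ Icc 0 (2 * π) ×ˢ U, ContDiffAt ℝ 1 (Function.uncurry φ) z := by
    rintro ⟨x, q⟩ ⟨hx, hq⟩
    have hc := (hT x hx q hq).1
    rw [contDiffAt_pi]
    intro i
    fin_cases i
    · simp only [Function.uncurry_def, φ, flowR, Fin.zero_eta, Matrix.cons_val_zero]
      fun_prop
    · simp only [Function.uncurry_def, φ, flowZ, shearP, curvP, Fin.mk_one, Matrix.cons_val_one,
        Matrix.cons_val_zero]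
      fun_prop
  have htube : ∀ x ∈ Icc 0 (2 * π), ∀ q ∈ U, tube sinCurve x (φ x q) =
      flow (-(q 0)) (-(q 1)) (x + T (x, q)) := by
    intro x hx q hq
    have h := (hT x hx q hq).2.1
    simp only [hitEq] at h
    rw [tube_sinCurve, flow, pt_add]
    simp only [φ, Matrix.cons_val_zero, Matrix.cons_val_one]
    congr 1
    · linear_combination -h
    · ring
    · ring
  refine ⟨φ (2 * π), U, hU, φ, fun x q => fderiv ℝ (Function.uncurry φ) (x, q) (1, 0),
    ⟨?_, ?_, ?_, ?_, ?_, ?_⟩, fun q _ => rfl⟩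
  · intro q hq
    have h := (hT 0 hpi q hq).2.2.1
    ext i
    fin_cases i
    · simp [φ, h, flowR]
    · simp [φ, h, flowZ, shearP, curvP]
  · intro x hx
    have h := (hT x hx 0 (mem_of_mem_nhds hU)).2.2.2.1
    ext i
    fin_cases i
    · simp [φ, h, flowR]
    · simp [φ, h, flowZ]
  · intro q hq x hx
    exact (((hφ (x, q) ⟨hx, hq⟩).differentiableAt (by simp)).hasFDerivAt.comp_hasDerivAt x
      ((hasDerivAt_id x).prodMk (hasDerivAt_const x q))).hasDerivWithinAt
  · exact fun z hz => (hφ z hz).continuousAt.continuousWithinAt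
  · intro z hz
    exact (((hφ z hz).fderiv_right (m := 0) (by simp)).continuousAt.clm_apply
      continuousAt_const).continuousWithinAt
  · intro q hq
    have hS : ∀ x ∈ Icc 0 (2 * π), ContDiffAt ℝ 1 (fun x => x + T (x, q)) x := by
      intro x hx
      have hc := (hT x hx q hq).1
      have : ContDiffAt ℝ 1 (fun x => T (x, q)) x :=
        hc.comp (x := x) (f := fun x => (x, q)) (by fun_prop)
      fun_prop
    refine ⟨ContDiffOn.congr (f := fun x => flow (-(q 0)) (-(q 1)) (x + T (x, q)))
      (fun x hx => ((contDiff_flow _ _).contDiffAt.comp x (hS x hx)).contDiffWithinAt)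
      (fun x hx => htube x hx q hq), fun x hx => ?_⟩
    obtain ⟨hc, -, -, -, hr, hpos⟩ := hT x hx q hq
    have h1 : HasDerivAt (fun x => x + T (x, q)) (1 + fderiv ℝ T (x, q) (1, 0)) x :=
      (hasDerivAt_id x).add ((hc.differentiableAt (by simp)).hasFDerivAt.comp_hasDerivAt x
        ((hasDerivAt_id x).prodMk (hasDerivAt_const x q)))
    have h2 := (hasDerivAt_flow (-(q 0)) (-(q 1)) (x + T (x, q))).scomp x h1
    rw [← fieldV_flow hr] at h2
    have h3 : derivWithin (fun x => tube sinCurve x (φ x q)) (Icc 0 (2 * π)) x = _ :=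
      (h2.hasDerivWithinAt.congr (fun x hx => htube x hx q hq)
        (htube x hx q hq)).derivWithin (uniqueDiffOn_Icc (by positivity) x hx)
    rw [h3]
    dsimp only
    rw [htube x hx q hq]
    exact isAsymptoticDirection_smul_fieldV hr _ _ hpos.ne'

/-! ### Asymptotic lines near the curve belong to the family. -/

/-- Angular component of a vector at a point. -/
def angC (p v : E3) : ℝ := v 0 * cs p - v 1 * sn p

/-- Radial component of a vector at a point. -/
def radC (p v : E3) : ℝ := v 0 * sn p + v 1 * cs p

/-- This function does not vanish on the asymptotic directions close to the direction field. -/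
def selector (p v : E3) : ℝ :=
  (-angC p v - 2 * (rad p - 1) * radC p v) * polarVW p +
    (rad p * radC p v - (rad p - 1) * angC p v) * quadW p

theorem continuous_selector : Continuous (fun w : E3 × E3 => selector w.1 w.2) := by
  have h1 := continuous_polarVW
  have h2 := continuous_quadW
  have h3 := contDiff_rad.continuous
  have h4 := contDiff_sn.continuous
  have h5 := contDiff_cs.continuous
  unfold selector angC radC
  fun_prop

theorem selector_sinCurve (t : ℝ) : selector (sinCurve t) (fieldV (sinCurve t)) ≠ 0 := by
  have h := sin_sq_add_cos_sq t
  have e1 : angC (sinCurve t) (fieldV (sinCurve t)) = 1 := by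
    rw [fieldV_sinCurve, angC, sinCurve_eq_pt, sn_pt one_half_lt_one, cs_pt one_half_lt_one]
    simp [cyl]
    linear_combination h
  have e2 : radC (sinCurve t) (fieldV (sinCurve t)) = 0 := by
    rw [fieldV_sinCurve, radC, sinCurve_eq_pt, sn_pt one_half_lt_one, cs_pt one_half_lt_one]
    simp [cyl]
    ring
  have e3 : rad (sinCurve t) = 1 := by rw [sinCurve_eq_pt, rad_pt one_half_lt_one]
  rw [selector, e1, e2, e3, polarVW_sinCurve]
  norm_num

/-- An asymptotic direction on which the selector does not vanish is parallel to the direction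
field. -/
theorem parallel_of_selector_ne_zero {p v : E3} (hp : sn p ^ 2 + cs p ^ 2 = 1)
    (hV : inner ℝ (fderiv ℝ fieldXi p (fieldV p)) (fieldV p) = 0)
    (h1 : inner ℝ (fieldXi p) v = 0) (h2 : inner ℝ (fderiv ℝ fieldXi p v) v = 0)
    (hs : selector p v ≠ 0) :
    rad p * radC p v = (rad p - 1) * angC p v ∧ rad p * v 2 = vel p * angC p v := by
  have hv : v = cyl (sn p) (cs p) (angC p v) (radC p v) (v 2) := cyl_eq hp v
  have hD := fieldXi_two_neg p
  have h1' : ((rad p - 1) * acc p + vel p) * angC p v +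
      (2 * (rad p - 1) * vel p - rad p * acc p) * radC p v +
        (-(rad p) - 2 * (rad p - 1) ^ 2) * v 2 = 0 := by
    rw [hv, fieldXi, inner_cyl, hp, one_mul] at h1
    exact h1
  -- Cramer's rule for `v` in the basis `V`, `W` of `ξ^⊥`; the determinant is the vertical component
  -- of `ξ`. With these coefficients `a`, `b`, the quantity `a β + b κ` is `selector p v`, so `b`
  -- must vanish.
  have hcomb : (-(rad p) - 2 * (rad p - 1) ^ 2) • v =
      (-angC p v - 2 * (rad p - 1) * radC p v) • fieldV p +
        (rad p * radC p v - (rad p - 1) * angC p v) • fieldW p := by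
    conv_lhs => rw [hv]
    rw [fieldV, fieldW, smul_cyl, smul_cyl, smul_cyl, add_cyl]
    congr 1
    · ring
    · ring
    · linear_combination h1'
  have hq := inner_fderiv_combination hV (-angC p v - 2 * (rad p - 1) * radC p v)
    (rad p * radC p v - (rad p - 1) * angC p v)
  rw [← hcomb, map_smul, real_inner_smul_left, real_inner_smul_right, h2, mul_zero,
    mul_zero] at hq
  have hβ := (mul_eq_zero.1 hq.symm).resolve_right hs
  refine ⟨by linarith, mul_left_cancel₀ hD.ne ?_⟩
  linear_combination (rad p) * h1' -
    (2 * (rad p - 1) * vel p - rad p * acc p) * hβ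

theorem hasDerivWithinAt_cyl {A B C θ : ℝ → ℝ} {A' B' C' θ' : ℝ} {S : Set ℝ} {x : ℝ}
    (hA : HasDerivWithinAt A A' S x) (hB : HasDerivWithinAt B B' S x)
    (hC : HasDerivWithinAt C C' S x) (hθ : HasDerivWithinAt θ θ' S x) :
    HasDerivWithinAt (fun x => cyl (sin (θ x)) (cos (θ x)) (A x) (B x) (C x))
      (cyl (sin (θ x)) (cos (θ x)) (A' + B x * θ') (B' - A x * θ') C') S x := by
  refine HasDerivWithinAt.congr_deriv (hasDerivWithinAt_vec3 ((hA.mul hθ.cos).add (hB.mul hθ.sin))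
    ((hA.mul hθ.sin).neg.add (hB.mul hθ.cos)) hC) ?_
  ext i
  fin_cases i <;> simp [cyl] <;> ring

/-- Velocity, in the space, of a curve given by its transversal coordinates. -/
def tubeVel (x : ℝ) (q p : Fin 2 → ℝ) : E3 :=
  cyl (sin x) (cos x)
    (p 1 * (3 * sin x ^ 2 * cos x) + q 1 * curvP (sin x) (cos x) + (1 - q 0))
    (-(p 0) - q 1 * (3 * sin x ^ 2 * cos x)) (3 * sin x ^ 2 * cos x - p 1)

theorem hasDerivAt_height_velocity (x : ℝ) :
    HasDerivAt (fun x => 3 * sin x ^ 2 * cos x) (curvP (sin x) (cos x)) x := by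
  refine HasDerivAt.congr_deriv
    ((((hasDerivAt_sin x).pow 2).const_mul 3).mul (hasDerivAt_cos x)) ?_
  push_cast
  simp only [curvP, Pi.pow_apply]
  ring

theorem hasDerivWithinAt_tube {f : ℝ → Fin 2 → ℝ} {f' : Fin 2 → ℝ} {S : Set ℝ} {x : ℝ}
    (hf : HasDerivWithinAt f f' S x) :
    HasDerivWithinAt (fun x => tube sinCurve x (f x)) (tubeVel x (f x) f') S x := by
  have h := hasDerivWithinAt_pi.1 hf
  simp only [tube_sinCurve]
  refine HasDerivWithinAt.congr_deriv (hasDerivWithinAt_cyl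
    ((h 1).mul (hasDerivAt_height_velocity x).hasDerivWithinAt) ((h 0).const_sub 1)
    ((((hasDerivAt_sin x).pow 3).hasDerivWithinAt).sub (h 1)) (hasDerivWithinAt_id x S)) ?_
  simp [tubeVel]

theorem tube_sinCurve_zero (x : ℝ) : tube sinCurve x 0 = sinCurve x := by
  simp [tube]

theorem tubeVel_zero (x : ℝ) : tubeVel x 0 0 = fieldV (sinCurve x) := by
  rw [fieldV_sinCurve]
  simp [tubeVel]

theorem continuous_cyl {X : Type*} [TopologicalSpace X] {f g h k l : X → ℝ} (hf : Continuous f)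
    (hg : Continuous g) (hh : Continuous h) (hk : Continuous k) (hl : Continuous l) :
    Continuous (fun p => cyl (f p) (g p) (h p) (k p) (l p)) := by
  refine (PiLp.continuous_toLp 2 _).comp (continuous_pi fun i => ?_)
  fin_cases i
  · simp; fun_prop
  · simp; fun_prop
  · simpa using hl

theorem continuous_tube : Continuous (fun w : ℝ × (Fin 2 → ℝ) => tube sinCurve w.1 w.2) := by
  simp only [tube_sinCurve]
  refine continuous_cyl ?_ ?_ ?_ ?_ ?_ <;> fun_prop

theorem continuous_tubeVel :
    Continuous (fun w : ℝ × (Fin 2 → ℝ) × (Fin 2 → ℝ) => tubeVel w.1 w.2.1 w.2.2) := by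
  unfold tubeVel curvP
  refine continuous_cyl ?_ ?_ ?_ ?_ ?_ <;> fun_prop

/-- The first integrals of the family of curves, in cylindrical coordinates. -/
theorem first_integrals {a b : ℝ} (hab : a < b) {r θ z r' θ' z' : ℝ → ℝ}
    (hr : ∀ x ∈ Icc a b, HasDerivWithinAt r (r' x) (Icc a b) x)
    (hθ : ∀ x ∈ Icc a b, HasDerivWithinAt θ (θ' x) (Icc a b) x)
    (hz : ∀ x ∈ Icc a b, HasDerivWithinAt z (z' x) (Icc a b) x)
    (h1 : ∀ x ∈ Icc a b, r' x = (r x - 1) * θ' x)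
    (h2 : ∀ x ∈ Icc a b,
      z' x = velP (sin (θ x)) (cos (θ x)) (r x - 1) (z x - sin (θ x) ^ 3) * θ' x) :
    (r b - 1) * exp (-θ b) = (r a - 1) * exp (-θ a) ∧
      (z b - sin (θ b) ^ 3 - shearP (sin (θ b)) (cos (θ b)) * (r b - 1)) * exp (25 / 16 * θ b) =
      (z a - sin (θ a) ^ 3 - shearP (sin (θ a)) (cos (θ a)) * (r a - 1)) *
        exp (25 / 16 * θ a) := by
  have key : ∀ f : ℝ → ℝ, (∀ x ∈ Icc a b, HasDerivWithinAt f 0 (Icc a b) x) → f b = f a := by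
    intro f hf
    exact constant_of_derivWithin_zero (fun x hx => (hf x hx).differentiableWithinAt)
      (fun x hx => (hf x (Ico_subset_Icc_self hx)).derivWithin
        (uniqueDiffOn_Icc hab x (Ico_subset_Icc_self hx))) b (right_mem_Icc.2 hab.le)
  constructor
  · refine key (fun x => (r x - 1) * exp (-θ x)) fun x hx => ?_
    refine (((hr x hx).sub_const 1).mul (hθ x hx).neg.exp).congr_deriv ?_
    rw [h1 x hx]
    ring
  · refine key (fun x => (z x - sin (θ x) ^ 3 - shearP (sin (θ x)) (cos (θ x)) * (r x - 1)) *
      exp (25 / 16 * θ x)) fun x hx => ?_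
    have hn : HasDerivWithinAt (fun x => shearP (sin (θ x)) (cos (θ x)))
        (dshearP (sin (θ x)) (cos (θ x)) * θ' x) (Icc a b) x :=
      (hasDerivAt_shear (θ x)).comp_hasDerivWithinAt x (hθ x hx)
    refine ((((hz x hx).sub ((hθ x hx).sin.pow 3)).sub (hn.mul ((hr x hx).sub_const 1))).mul
      ((hθ x hx).const_mul (25 / 16)).exp).congr_deriv ?_
    rw [h1 x hx, h2 x hx, velP, coupP]
    push_cast
    simp only [Pi.sub_apply, Pi.mul_apply, Pi.pow_apply]
    ring

/-- Asymptotic lines which remain close to the curve, and whose direction stays close to the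
direction of the curve, have an explicit return point. -/
theorem return_point {f f' : ℝ → Fin 2 → ℝ}
    (hf : ∀ x ∈ Icc 0 (2 * π), HasDerivWithinAt f (f' x) (Icc 0 (2 * π)) x)
    (hasym : ∀ x ∈ Icc 0 (2 * π),
      IsAsymptoticDirection fieldXi (tube sinCurve x (f x)) (tubeVel x (f x) (f' x)))
    (hsmall : ∀ x ∈ Icc 0 (2 * π), f x 0 < 1 / 2)
    (hsel : ∀ x ∈ Icc 0 (2 * π), selector (tube sinCurve x (f x)) (tubeVel x (f x) (f' x)) ≠ 0) :
    f (2 * π) = ![exp (2 * π) * f 0 0, exp (-(25 * π / 8)) * f 0 1] := by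
  have hpi : (0 : ℝ) < 2 * π := by positivity
  -- The tangent of the angle between the point and the radial direction at `x`, which yields global
  -- cylindrical coordinates along the line without choosing a branch of the angle.
  let m : ℝ → ℝ := fun x => f x 1 * (3 * sin x ^ 2 * cos x) / (1 - f x 0)
  let r : ℝ → ℝ := fun x => (1 - f x 0) * √(1 + m x ^ 2)
  let θ : ℝ → ℝ := fun x => x + arctan (m x)
  let z : ℝ → ℝ := fun x => sin x ^ 3 - f x 1
  have hmd : ∀ x ∈ Icc 0 (2 * π), DifferentiableWithinAt ℝ m (Icc 0 (2 * π)) x := by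
    intro x hx
    have h := hasDerivWithinAt_pi.1 (hf x hx)
    exact (((h 1).mul (hasDerivAt_height_velocity x).hasDerivWithinAt).div ((h 0).const_sub 1)
      (by linarith [hsmall x hx])).differentiableWithinAt
  have hr : ∀ x ∈ Icc 0 (2 * π),
      HasDerivWithinAt r (derivWithin r (Icc 0 (2 * π)) x) (Icc 0 (2 * π)) x := by
    intro x hx
    have h := hasDerivWithinAt_pi.1 (hf x hx)
    refine DifferentiableWithinAt.hasDerivWithinAt ?_
    exact ((h 0).const_sub 1).differentiableWithinAt.mul
      ((((hmd x hx).pow 2).const_add 1).sqrt (by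
        change 1 + m x ^ 2 ≠ 0
        positivity))
  have hθ : ∀ x ∈ Icc 0 (2 * π),
      HasDerivWithinAt θ (derivWithin θ (Icc 0 (2 * π)) x) (Icc 0 (2 * π)) x := by
    intro x hx
    exact (differentiableWithinAt_id.add (hmd x hx).arctan).hasDerivWithinAt
  have hz : ∀ x ∈ Icc 0 (2 * π),
      HasDerivWithinAt z (derivWithin z (Icc 0 (2 * π)) x) (Icc 0 (2 * π)) x := by
    intro x hx
    have h := hasDerivWithinAt_pi.1 (hf x hx)
    exact (((hasDerivAt_sin x).pow 3).hasDerivWithinAt.sub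
      (h 1)).differentiableWithinAt.hasDerivWithinAt
  have hr2 : ∀ x ∈ Icc 0 (2 * π), 1 / 2 < r x := by
    intro x hx
    have h1 : 1 ≤ √(1 + m x ^ 2) := Real.one_le_sqrt.2 (by nlinarith [sq_nonneg (m x)])
    have h2 := hsmall x hx
    calc 1 / 2 < 1 - f x 0 := by linarith
      _ ≤ r x := le_mul_of_one_le_right (by linarith) h1
  have htube : ∀ x ∈ Icc 0 (2 * π), tube sinCurve x (f x) = pt (r x) (θ x) (z x) := by
    intro x hx
    have h2 := hsmall x hx
    have h3 : 0 < √(1 + m x ^ 2) := Real.sqrt_pos.2 (by positivity)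
    rw [tube_sinCurve, pt_add, sin_arctan, cos_arctan]
    congr 1
    · simp only [r]
      field_simp
      simp only [m]
      field_simp [show (1 - f x 0) ≠ 0 by linarith]
    · simp only [r]
      field_simp
  have hvel : ∀ x ∈ Icc 0 (2 * π), tubeVel x (f x) (f' x) = cyl (sin (θ x)) (cos (θ x))
      (r x * derivWithin θ (Icc 0 (2 * π)) x) (derivWithin r (Icc 0 (2 * π)) x)
      (derivWithin z (Icc 0 (2 * π)) x) := by
    intro x hx
    have h1 := hasDerivWithinAt_tube (hf x hx)
    have h2 := hasDerivWithinAt_cyl (hasDerivWithinAt_const x (Icc 0 (2 * π)) (0 : ℝ))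
      (hr x hx) (hz x hx) (hθ x hx)
    have h3 : ∀ y ∈ Icc 0 (2 * π), tube sinCurve y (f y) =
        cyl (sin (θ y)) (cos (θ y)) 0 (r y) (z y) := by
      intro y hy
      rw [htube y hy]
      simp [pt, cyl]
    have hu := uniqueDiffOn_Icc hpi x hx
    rw [← h1.derivWithin hu, (h2.congr h3 (h3 x hx)).derivWithin hu]
    simp
  have hpar : ∀ x ∈ Icc 0 (2 * π),
      derivWithin r (Icc 0 (2 * π)) x = (r x - 1) * derivWithin θ (Icc 0 (2 * π)) x ∧
      derivWithin z (Icc 0 (2 * π)) x =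
        velP (sin (θ x)) (cos (θ x)) (r x - 1) (z x - sin (θ x) ^ 3) *
          derivWithin θ (Icc 0 (2 * π)) x := by
    intro x hx
    have hr2x := hr2 x hx
    have ha := hasym x hx
    have hs := hsel x hx
    rw [htube x hx] at ha hs
    have hsc := sin_sq_add_cos_sq (θ x)
    obtain ⟨k1, k2⟩ := parallel_of_selector_ne_zero (sn_sq_add_cs_sq hr2x _ _)
      (inner_fderiv_fieldV_fieldV hr2x _ _) ha.2.1 ha.2.2 hs
    have e1 : angC (pt (r x) (θ x) (z x)) (tubeVel x (f x) (f' x)) =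
        r x * derivWithin θ (Icc 0 (2 * π)) x := by
      rw [hvel x hx, angC, sn_pt hr2x, cs_pt hr2x]
      simp [cyl]
      linear_combination r x * derivWithin θ (Icc 0 (2 * π)) x * hsc
    have e2 : radC (pt (r x) (θ x) (z x)) (tubeVel x (f x) (f' x)) =
        derivWithin r (Icc 0 (2 * π)) x := by
      rw [hvel x hx, radC, sn_pt hr2x, cs_pt hr2x]
      simp [cyl]
      linear_combination derivWithin r (Icc 0 (2 * π)) x * hsc
    have e3 : tubeVel x (f x) (f' x) 2 = derivWithin z (Icc 0 (2 * π)) x := by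
      rw [hvel x hx]
      simp [cyl]
    rw [e1, e2, rad_pt hr2x] at k1
    rw [e1, e3, rad_pt hr2x, vel_pt hr2x] at k2
    have hr0 : r x ≠ 0 := by linarith
    exact ⟨mul_left_cancel₀ hr0 (by linear_combination k1),
      mul_left_cancel₀ hr0 (by linear_combination k2)⟩
  obtain ⟨i1, i2⟩ := first_integrals hpi hr hθ hz (fun x hx => (hpar x hx).1)
    (fun x hx => (hpar x hx).2)
  -- At `x = 0` and `x = 2π` the sine vanishes, hence `m = 0`, `θ = x`, `r - 1 = -y`, the height is
  -- `-z` and the shear is zero: the first integrals directly relate the endpoint coordinates.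
  simp [r, θ, z, m, shearP, curvP] at i1 i2
  have e1 : exp (2 * π) * exp (-(2 * π)) = 1 := by rw [← exp_add]; simp
  have e2 : exp (-(25 * π / 8)) * exp (25 / 16 * (2 * π)) = 1 := by
    rw [← exp_add, exp_eq_one_iff]
    ring
  ext i
  fin_cases i
  · simp only [Fin.zero_eta, Matrix.cons_val_zero]
    linear_combination exp (2 * π) * i1 - f (2 * π) 0 * e1
  · simp only [Fin.mk_one, Matrix.cons_val_one, Matrix.cons_val_zero]
    linear_combination exp (-(25 * π / 8)) * i2 - f (2 * π) 1 * e2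

theorem continuousOn_tubeVel {K : Set (ℝ × (Fin 2 → ℝ))} {f g : ℝ × (Fin 2 → ℝ) → Fin 2 → ℝ}
    (hf : ContinuousOn f K) (hg : ContinuousOn g K) :
    ContinuousOn (fun w => tubeVel w.1 (f w) (g w)) K := by
  have h : ContinuousOn (fun w => (w.1, f w, g w)) K := continuousOn_fst.prodMk (hf.prodMk hg)
  simpa only [Function.comp_def] using continuous_tubeVel.comp_continuousOn h

theorem continuousOn_selector_tube {K : Set (ℝ × (Fin 2 → ℝ))}
    {f g : ℝ × (Fin 2 → ℝ) → Fin 2 → ℝ} (hf : ContinuousOn f K) (hg : ContinuousOn g K) :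
    ContinuousOn (fun w => selector (tube sinCurve w.1 (f w)) (tubeVel w.1 (f w) (g w))) K := by
  have h1 : ContinuousOn (fun w => (w.1, f w)) K := continuousOn_fst.prodMk hf
  have h2 := continuous_tube.comp_continuousOn h1
  simp only [Function.comp_def] at h2
  have h3 := continuous_selector.comp_continuousOn (h2.prodMk (continuousOn_tubeVel hf hg))
  simpa only [Function.comp_def] using h3

/-- Near the origin, the return point is a linear function of the initial point. -/
theorem eventually_return_point {U : Set (Fin 2 → ℝ)} (hU : U ∈ 𝓝 0)
    {φ ψ : ℝ → (Fin 2 → ℝ) → (Fin 2 → ℝ)}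
    (h : IsAsymptoticFamily fieldXi sinCurve (2 * π) U φ ψ) :
    ∀ᶠ q in 𝓝 (0 : Fin 2 → ℝ),
      φ (2 * π) q = ![exp (2 * π) * q 0, exp (-(25 * π / 8)) * q 1] := by
  have hpi : (0 : ℝ) < 2 * π := by positivity
  have h0U := mem_of_mem_nhds hU
  -- This fixes the branch: at `q = 0` the velocity is `V`, where the selector is nonzero, and
  -- continuity of `ψ` with compactness of the period keeps it nonzero for all small `q`.
  have hψ0 : ∀ x ∈ Icc 0 (2 * π), ψ x 0 = 0 := by
    intro x hx
    have h1 := h.hasDeriv 0 h0U x hx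
    have h2 := (hasDerivWithinAt_const x (Icc 0 (2 * π)) (0 : Fin 2 → ℝ)).congr h.base
      (h.base x hx)
    have hu := uniqueDiffOn_Icc hpi x hx
    rw [← h1.derivWithin hu, h2.derivWithin hu]
  have hcφ : ContinuousOn (fun w : ℝ × (Fin 2 → ℝ) => φ w.1 w.2) (Icc 0 (2 * π) ×ˢ U) :=
    h.continuousOn
  have hcψ : ContinuousOn (fun w : ℝ × (Fin 2 → ℝ) => ψ w.1 w.2) (Icc 0 (2 * π) ×ˢ U) :=
    h.continuousOn_deriv
  have hsel : ContinuousOn (fun w : ℝ × (Fin 2 → ℝ) => selector (tube sinCurve w.1 (φ w.1 w.2))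
      (tubeVel w.1 (φ w.1 w.2) (ψ w.1 w.2))) (Icc 0 (2 * π) ×ˢ U) :=
    continuousOn_selector_tube hcφ hcψ
  have hc0 : ContinuousOn (fun w : ℝ × (Fin 2 → ℝ) => φ w.1 w.2 0) (Icc 0 (2 * π) ×ˢ U) :=
    (continuous_apply 0).comp_continuousOn hcφ
  have hswap : ∀ x, Filter.Tendsto (Prod.swap : (Fin 2 → ℝ) × ℝ → _) (𝓝 (0, x)) (𝓝 (x, 0)) :=
    fun x => continuous_swap.tendsto (0, x)
  have hev := isCompact_Icc.eventually_forall_of_forall_eventually (x₀ := (0 : Fin 2 → ℝ))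
    (K := Icc 0 (2 * π)) (P := fun q x => (x, q) ∈ Icc 0 (2 * π) ×ˢ U → φ x q 0 < 1 / 2 ∧
      selector (tube sinCurve x (φ x q)) (tubeVel x (φ x q) (ψ x q)) ≠ 0) (by
    intro x hx
    have hmem : (x, (0 : Fin 2 → ℝ)) ∈ Icc 0 (2 * π) ×ˢ U := ⟨hx, h0U⟩
    have e1 := (hc0 _ hmem).eventually (p := fun y => y < 1 / 2) (gt_mem_nhds (by
      simp [h.base x hx]))
    have e2 := (hsel _ hmem).eventually (p := fun y => y ≠ 0) (isOpen_ne.mem_nhds (by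
      simp only [h.base x hx, hψ0 x hx, tube_sinCurve_zero, tubeVel_zero]
      exact selector_sinCurve x))
    have e3 := eventually_nhdsWithin_iff.1 (e1.and e2)
    filter_upwards [(hswap x).eventually e3] with z hz hzm
    exact hz hzm)
  filter_upwards [hev, hU] with q hq hqU
  have hd := h.hasDeriv q hqU
  have hgood := fun x (hx : x ∈ Icc 0 (2 * π)) => hq x hx ⟨hx, hqU⟩
  have key := return_point hd (fun x hx => by
    have ha := (h.asymptotic q hqU).2 x hx
    rwa [(hasDerivWithinAt_tube (hd x hx)).derivWithin (uniqueDiffOn_Icc hpi x hx)] at ha)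
    (fun x hx => (hgood x hx).1) fun x hx => (hgood x hx).2
  rwa [h.initial q hqU] at key

/-! ### The derivative of the Poincaré map and hyperbolicity. -/

theorem hasPoincareDerivative_sinCurve : HasPoincareDerivative fieldXi sinCurve (2 * π)
    (Matrix.diagonal ![exp (2 * π), exp (-(25 * π / 8))]) := by
  refine ⟨exists_isPoincareMap, ?_⟩
  rintro P ⟨U, hU, φ, ψ, h, hP⟩
  refine (ContinuousLinearMap.hasFDerivAt _).congr_of_eventuallyEq ?_
  filter_upwards [eventually_return_point hU h, hU] with q hq hqU
  rw [hP q hqU, hq]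
  ext i
  fin_cases i <;> simp [Matrix.mulVec_diagonal]

theorem isHyperbolicClosedLine_sinCurve : IsHyperbolicClosedLine fieldXi sinCurve (2 * π) := by
  refine ⟨isClosedAsymptoticLine_sinCurve, not_isParabolicPoint_sinCurve,
    hasLocallyConvexProjection_sinCurve, _, hasPoincareDerivative_sinCurve, ?_⟩
  intro μ hμ
  rw [Matrix.diagonal_map (map_zero _), spectrum_diagonal] at hμ
  obtain ⟨i, rfl⟩ := hμ
  fin_cases i
  · have := Complex.norm_exp_ofReal (2 * π)
    push_cast at this
    simp [this]
  · have := Complex.norm_exp_ofReal (-(25 * π / 8))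
    push_cast at this
    simp [this]

theorem theorem4p3 :
    IsFiniteTypeCurve sinCurve ∧
      ∃ ξ : E3 → E3, IsPlaneField ∞ ξ ∧
        IsHyperbolicClosedLine ξ sinCurve (2 * π) ∧
        HasPoincareDerivative ξ sinCurve (2 * π)
          (Matrix.diagonal ![exp (2 * π), exp (-(25 * π / 8))]) :=
  ⟨isFiniteTypeCurve_sinCurve, fieldXi, isPlaneField_fieldXi, isHyperbolicClosedLine_sinCurve,
    hasPoincareDerivative_sinCurve⟩

end
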